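/- Let $U\subset\mathbb R^2$ be open, with coordinates $(x,y)$. A Samuelson web (S-web) on $U$, in canonical normalization, consists of four pairwise linearly independent $1$-forms $\omega_1,\dots,\omega_4$ and smooth functions $f$ (the web function) and $b$ on $U$ with $$\omega_3\wedge\omega_1+\omega_4\wedge\omega_2=0,\quad \omega_1+\omega_2+\omega_3=0,\quad \omega_4+\omega_1+b\,\omega_2=0,\quad \omega_3=df,\quad \omega_1\wedge dx=0,\quad \omega_2\wedge dy=0 .$$ (Thus $f_x,f_y\ne0$ and $b\ne0,1$.) Write $\partial_1=-\frac1{f_x}\partial_x$, $\partial_2=-\frac1{f_y}\partial_y$ (the frame dual to $\omega_1,\omega_2$), $p_i=\partial_i p$, $p_{ij}=\partial_i\partial_j p$, $\delta=\partial_1-\partial_2$, and $$H=\frac{f_{xy}}{f_xf_y},\qquad K=-\frac1{f_xf_y}\Bigl(\log\Bigl|\frac{f_x}{f_y}\Bigr|\Bigr)_{xy}.$$ Let $\delta_i$ be the covariant derivative along the Chern connection: $\delta_i u=\partial_i u-kHu$ for $u$ of weight $k$, the result having weight $k+1$. As $\log|b|$ has weight $0$, $\delta_2\delta_1\log|b|=\partial_2\partial_1\log|b|-H\,\partial_1\log|b|$.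 The Samuelson equations for functions $\sigma_1,\sigma_2,\tau_1,\tau_2$ are $$\partial_2\sigma_1=H,\quad \partial_1\sigma_2=H,\quad \partial_2\tau_1-\partial_1\tau_1=0,\quad b\,\partial_1\tau_2-\partial_2\tau_2=(b-1)H-b_1,\quad \sigma_1+\tau_1=\sigma_2+\tau_2 .$$ Put $r=H-\frac{b_1}{b}$, $B=2bH-b_1-(b-1)\,\partial_1\tau_1$ and $R=\frac{B_1-H_2+H^2-HB}{b}$. The compatibility conditions are $$\text{(C1)}\quad R_2+rH_1-rH^2-H_{11}+3HH_1-H^3-2HR=0,\qquad \text{(C2)}\quad r_2+H^2-H_1-rH=0 .$$ The compatibility system consists of the Samuelson equations together with (C1) and (C2). The rank of the S-web at $p\in U$ is the dimension of the affine space of germs at $p$ of smooth solutions $(\sigma_1,\sigma_2,\tau_1,\tau_2)$ of the compatibility system ($0$ if there are no solutions). Theorem. (i) There are smooth functions $T_0,T_1,T_2,T_3$ on $U$, namely $$T_3=\tfrac{b-1}{b},\qquad T_2=2HT_3-\partial_2T_3-c,\qquad T_1=\partial_2c-2Hc,\qquad c=\tfrac{b_1-H(b-1)}{b},$$ and $T_0$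 the left-hand side of (C1) for $\tau_1=0$, such that $T_3$ vanishes nowhere and, for $\tau_1=w(f)$ with $w$ a smooth function of one variable, the left-hand side of (C1) equals $T_3w'''(f)+T_2w''(f)+T_1w'(f)+T_0$. (ii) The rank of the S-web at every $p\in U$ is at most six, and it equals six if and only if in a neighbourhood of $p$ $$K=-\delta_2\delta_1\log|b|,\qquad \delta\Bigl(\frac{T_2}{T_3}\Bigr)=\delta\Bigl(\frac{T_1}{T_3}\Bigr)=\delta\Bigl(\frac{T_0}{T_3}\Bigr)=0 .$$ In particular, the rank is six at every point of $U$ if and only if these conditions hold on $U$. -/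

import Mathlib

open Filter Topology
open scoped ContDiff

noncomputable section

namespace Samuelson

/-- Covectors of the coordinate plane with coordinates `(x, y)`. -/
abbrev Covector : Type := ℝ × ℝ →L[ℝ] ℝ

/-- The coefficient of `dx ∧ dy` in the exterior product of two covectors. -/
def wedge (α β : Covector) : ℝ := α (1, 0) * β (0, 1) - α (0, 1) * β (1, 0)

/-- The partial derivative with respect to `x`. -/
def partialX (u : ℝ × ℝ → ℝ) : ℝ × ℝ → ℝ := fun q => fderiv ℝ u q (1, 0)

/-- The partial derivative with respect to `y`. -/
def partialY (u : ℝ × ℝ → ℝ) : ℝ × ℝ → ℝ := fun q => fderiv ℝ u q (0, 1)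

/-- A Samuelson web on an open set `U` of the `(x, y)`-plane, in canonical normalization:
four pairwise independent 1-forms with `ω₃ ∧ ω₁ + ω₄ ∧ ω₂ = 0`, `ω₁ + ω₂ + ω₃ = 0`,
`ω₄ + ω₁ + b ω₂ = 0`, where `ω₃ = df` and the first two foliations are
`x = const` and `y = const`. -/
structure Web where
  U : Set (ℝ × ℝ)
  isOpen_U : IsOpen U
  f : ℝ × ℝ → ℝ
  smooth_f : ContDiffOn ℝ ∞ f U
  b : ℝ × ℝ → ℝ
  smooth_b : ContDiffOn ℝ ∞ b U
  ω₁ : ℝ × ℝ → Covector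
  ω₂ : ℝ × ℝ → Covector
  ω₃ : ℝ × ℝ → Covector
  ω₄ : ℝ × ℝ → Covector
  pairwise_independent : ∀ q ∈ U,
    wedge (ω₁ q) (ω₂ q) ≠ 0 ∧ wedge (ω₁ q) (ω₃ q) ≠ 0 ∧ wedge (ω₁ q) (ω₄ q) ≠ 0 ∧
    wedge (ω₂ q) (ω₃ q) ≠ 0 ∧ wedge (ω₂ q) (ω₄ q) ≠ 0 ∧ wedge (ω₃ q) (ω₄ q) ≠ 0
  samuelson : ∀ q ∈ U, wedge (ω₃ q) (ω₁ q) + wedge (ω₄ q) (ω₂ q) = 0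
  normalization₁ : ∀ q ∈ U, ω₁ q + ω₂ q + ω₃ q = 0
  normalization₂ : ∀ q ∈ U, ω₄ q + ω₁ q + b q • ω₂ q = 0
  ω₃_eq : ∀ q ∈ U, ω₃ q = fderiv ℝ f q
  ω₁_dx : ∀ q ∈ U, wedge (ω₁ q) (ContinuousLinearMap.fst ℝ ℝ ℝ) = 0
  ω₂_dy : ∀ q ∈ U, wedge (ω₂ q) (ContinuousLinearMap.snd ℝ ℝ ℝ) = 0

namespace Web

variable (W : Web)

/-- The vector field `∂₁ = -(1 / f_x) ∂/∂x`. -/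
def frame₁ (q : ℝ × ℝ) : ℝ × ℝ := (-(1 / partialX W.f q), 0)

/-- The vector field `∂₂ = -(1 / f_y) ∂/∂y`. -/
def frame₂ (q : ℝ × ℝ) : ℝ × ℝ := (0, -(1 / partialY W.f q))

/-- The frame `∂₁, ∂₂` is dual to the coframe `ω₁, ω₂`. -/
theorem frame_dual {q : ℝ × ℝ} (hq : q ∈ W.U) :
    W.ω₁ q (W.frame₁ q) = 1 ∧ W.ω₁ q (W.frame₂ q) = 0 ∧
    W.ω₂ q (W.frame₁ q) = 0 ∧ W.ω₂ q (W.frame₂ q) = 1 := by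
  have h1 : W.ω₁ q (0, 1) = 0 := by
    have := W.ω₁_dx q hq
    simpa [wedge] using this
  have h2 : W.ω₂ q (1, 0) = 0 := by
    have := W.ω₂_dy q hq
    simpa [wedge] using this
  have hx : W.ω₁ q (1, 0) = -partialX W.f q := by
    have := congrArg (fun α : Covector => α (1, 0)) (W.normalization₁ q hq)
    simp only [W.ω₃_eq q hq, add_apply, h2,
      zero_apply] at this
    simp only [partialX]
    linarith
  have hy : W.ω₂ q (0, 1) = -partialY W.f q := by
    have := congrArg (fun α : Covector => α (0, 1)) (W.normalization₁ q hq)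
    simp only [W.ω₃_eq q hq, add_apply, h1,
      zero_apply] at this
    simp only [partialY]
    linarith
  have hne := (W.pairwise_independent q hq).1
  simp only [wedge, h1, h2, hx, hy] at hne
  have hfx : partialX W.f q ≠ 0 := by
    intro h
    simp [h] at hne
  have hfy : partialY W.f q ≠ 0 := by
    intro h
    simp [h] at hne
  have e1 : W.frame₁ q = (-(1 / partialX W.f q)) • ((1, 0) : ℝ × ℝ) := by
    simp [frame₁]
  have e2 : W.frame₂ q = (-(1 / partialY W.f q)) • ((0, 1) : ℝ × ℝ) := by
    simp [frame₂]
  simp only [e1, e2, map_smul, h1, h2, hx, hy, smul_eq_mul]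
  refine ⟨?_, by simp, by simp, ?_⟩ <;> field_simp

/-- The derivation `u ↦ u₁ = ∂₁ u`. -/
def D₁ (u : ℝ × ℝ → ℝ) : ℝ × ℝ → ℝ := fun q => fderiv ℝ u q (W.frame₁ q)

/-- The derivation `u ↦ u₂ = ∂₂ u`. -/
def D₂ (u : ℝ × ℝ → ℝ) : ℝ × ℝ → ℝ := fun q => fderiv ℝ u q (W.frame₂ q)

/-- `H = f_xy / (f_x f_y)`. -/
def H : ℝ × ℝ → ℝ := fun q =>
  partialY (partialX W.f) q / (partialX W.f q * partialY W.f q)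

/-- The scalar curvature `K = -(1 / (f_x f_y)) (log (f_x / f_y))_xy` of the 3-web
`⟨ω₁, ω₂, ω₃⟩`.  (Here `Real.log t = log |t|`.) -/
def K : ℝ × ℝ → ℝ := fun q =>
  -(1 / (partialX W.f q * partialY W.f q)) *
    partialY (partialX fun z => Real.log (partialX W.f z / partialY W.f z)) q

/-- The covariant derivative `δ₁ u = ∂₁ u - k H u` along the Chern connection of a function `u`
of weight `k`; it has weight `k + 1`. -/
def covD₁ (k : ℕ) (u : ℝ × ℝ → ℝ) : ℝ × ℝ → ℝ := fun q => W.D₁ u q - k * W.H q * u q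

/-- The covariant derivative `δ₂ u = ∂₂ u - k H u` along the Chern connection of a function `u`
of weight `k`; it has weight `k + 1`. -/
def covD₂ (k : ℕ) (u : ℝ × ℝ → ℝ) : ℝ × ℝ → ℝ := fun q => W.D₂ u q - k * W.H q * u q

/-- The derivation `δ = ∂₁ - ∂₂`. -/
def δ (u : ℝ × ℝ → ℝ) : ℝ × ℝ → ℝ := fun q => W.D₁ u q - W.D₂ u q

/-- The Samuelson equations at the point `q`, for the logarithms `σ₁, σ₂, τ₁, τ₂` of
factors `s₁, s₂, t₁, t₂` which make `s₁ ω₁`, `s₂ ω₂`, `t₁ ω₃`, `t₂ ω₄` closed with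
`s₁ t₁ = s₂ t₂`. -/
def SamuelsonEquations (σ₁ σ₂ τ₁ τ₂ : ℝ × ℝ → ℝ) (q : ℝ × ℝ) : Prop :=
  W.D₂ σ₁ q = W.H q ∧
  W.D₁ σ₂ q = W.H q ∧
  W.D₂ τ₁ q - W.D₁ τ₁ q = 0 ∧
  W.b q * W.D₁ τ₂ q - W.D₂ τ₂ q = (W.b q - 1) * W.H q - W.D₁ W.b q ∧
  σ₁ q + τ₁ q = σ₂ q + τ₂ q

/-- The right-hand side `B` of the reduced equation `b ∂₁σ₁ + ∂₂σ₂ = B`.  If `τ₁ = w(f)`, then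
`∂₁ τ₁ = -w'(f)` and `B = 2 b H - ∂₁ b + (b - 1) w'(f)`. -/
def B (τ₁ : ℝ × ℝ → ℝ) : ℝ × ℝ → ℝ := fun q =>
  2 * W.b q * W.H q - W.D₁ W.b q - (W.b q - 1) * W.D₁ τ₁ q

/-- `R` and `r` are the coefficients of the prolonged equation `∂₁∂₁σ₁ = R + r ∂₁σ₁`. -/
def R (τ₁ : ℝ × ℝ → ℝ) : ℝ × ℝ → ℝ := fun q =>
  (W.D₁ (W.B τ₁) q - W.D₂ W.H q + W.H q ^ 2 - W.H q * W.B τ₁ q) / W.b q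

/-- See `R`. -/
def r : ℝ × ℝ → ℝ := fun q => W.H q - W.D₁ W.b q / W.b q

/-- The left-hand side of the first compatibility condition. -/
def compat₁ (τ₁ : ℝ × ℝ → ℝ) : ℝ × ℝ → ℝ := fun q =>
  W.D₂ (W.R τ₁) q + W.r q * W.D₁ W.H q - W.r q * W.H q ^ 2 - W.D₁ (W.D₁ W.H) q
    + 3 * W.H q * W.D₁ W.H q - W.H q ^ 3 - 2 * W.H q * W.R τ₁ q

/-- The left-hand side of the second compatibility condition. -/
def compat₂ : ℝ × ℝ → ℝ := fun q =>
  W.D₂ W.r q + W.H q ^ 2 - W.D₁ W.H q - W.r q * W.H q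

/-- The solutions near `p` of the compatibility system: smooth solutions of the Samuelson
equations for which both compatibility conditions hold. -/
def IsSolutionNear (p : ℝ × ℝ) (σ₁ σ₂ τ₁ τ₂ : ℝ × ℝ → ℝ) : Prop :=
  ∀ᶠ q in 𝓝 p,
    (ContDiffAt ℝ ∞ σ₁ q ∧ ContDiffAt ℝ ∞ σ₂ q ∧ ContDiffAt ℝ ∞ τ₁ q ∧ ContDiffAt ℝ ∞ τ₂ q) ∧
    W.SamuelsonEquations σ₁ σ₂ τ₁ τ₂ q ∧
    W.compat₁ τ₁ q = 0 ∧
    W.compat₂ q = 0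

/-- Germs at `p` of real functions. -/
abbrev GermAt (p : ℝ × ℝ) : Type := Filter.Germ (𝓝 p) ℝ

/-- The set of germs at `p` of solutions of the compatibility system; it is empty or an affine
subspace. -/
def solutionGerms (p : ℝ × ℝ) : Set (GermAt p × GermAt p × GermAt p × GermAt p) :=
  {φ | ∃ σ₁ σ₂ τ₁ τ₂ : ℝ × ℝ → ℝ, W.IsSolutionNear p σ₁ σ₂ τ₁ τ₂ ∧
    φ = ((σ₁ : GermAt p), (σ₂ : GermAt p), (τ₁ : GermAt p), (τ₂ : GermAt p))}

/-- The rank of the Samuelson web at `p`: the dimension of the affine space of germs at `p` of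
solutions of the compatibility system (`0` if there are none). -/
def rank (p : ℝ × ℝ) : Cardinal := Module.rank ℝ (vectorSpan ℝ (W.solutionGerms p))

/-- The coefficient `T₃` of `w'''(f)` in the first compatibility condition. -/
def T₃ : ℝ × ℝ → ℝ := fun q => (W.b q - 1) / W.b q

/-- The coefficient of `w'(f)` in `R`. -/
def c : ℝ × ℝ → ℝ := fun q => (W.D₁ W.b q - W.H q * (W.b q - 1)) / W.b q

/-- The coefficient `T₂` of `w''(f)` in the first compatibility condition. -/
def T₂ : ℝ × ℝ → ℝ := fun q => 2 * W.H q * W.T₃ q - W.D₂ W.T₃ q - W.c q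

/-- The coefficient `T₁` of `w'(f)` in the first compatibility condition. -/
def T₁ : ℝ × ℝ → ℝ := fun q => W.D₂ W.c q - 2 * W.H q * W.c q

/-- The free term `T₀` of the first compatibility condition, its value for `w = 0`. -/
def T₀ : ℝ × ℝ → ℝ := W.compat₁ (fun _ => 0)

/-- The condition `K = -δ₂ δ₁ log b` at the point `q` (the function `log b` has weight `0`). -/
def CurvatureCondition (q : ℝ × ℝ) : Prop :=
  W.K q = -(W.covD₂ 1 (W.covD₁ 0 fun z => Real.log (W.b z)) q)

/-- The conditions `δ(T₂/T₃) = δ(T₁/T₃) = δ(T₀/T₃) = 0` at the point `q`. -/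
def CoefficientCondition (q : ℝ × ℝ) : Prop :=
  W.δ (fun z => W.T₂ z / W.T₃ z) q = 0 ∧
  W.δ (fun z => W.T₁ z / W.T₃ z) q = 0 ∧
  W.δ (fun z => W.T₀ z / W.T₃ z) q = 0

end Web

end Samuelson

end

/-!
The compatibility system is turned into a linear system of total differential equations with six
unknowns, and the rank is read off from its integrability.

Because `[∂₁, ∂₂] = H (∂₂ - ∂₁)`, the equation `∂₂τ₁ = ∂₁τ₁` is inherited by `v = ∂₁τ₁`, `a = ∂₁v`
and `∂₁a`, and the first compatibility condition becomes `T₀ - T₁ v + T₂ a - T₃ ∂₁a = 0`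
(`compat₁_eq`); for `τ₁ = w(f)`, where `∂₁` and `∂₂` act as `-d/dt`, this is the third-order
equation for `w` (`compat₁_comp_f`). Eliminating `τ₂`, the function `s = ∂₁σ₁` satisfies
`∂₁s = R + r s` and `∂₂s = ∂₁H - H² + H s`. Hence the values of `τ₁, v, a, σ₁, σ₂, s` at `p`
determine the germ of a solution, by Grönwall's inequality (`germs_eq_zero_of_initialData`). The
direction of the affine space of solutions therefore embeds into `ℝ⁶`, which gives the bound on the
rank, and the rank is six exactly when a solution exists and every vector of `ℝ⁶` consists of
initial data of a homogeneous solution.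

If this is so, applying `δ` to the equation for `τ₁`, solved for `∂₁a`, yields
`δ(T₀/T₃) - δ(T₁/T₃) v + δ(T₂/T₃) a = 0` (`SolvesNear.integrability`); since `v` and `a` can be
prescribed independently near `p`, all three coefficients vanish. The curvature condition is the
second compatibility condition, as `K = ∂₁H - ∂₂H` (`K_eq`, `compat₂_eq_zero_iff`).

Conversely, if the conditions hold, the `Tᵢ/T₃` are smooth functions of `f`
(`exists_eq_comp_f`), so `w` is obtained from a linear ordinary differential equation
(`exists_solution_linear_ode`), and `s`, `σ₁`, `σ₂` follow by the Poincaré lemma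
(`exists_primitive`, `exists_prolonged`), with six free constants in all (`exists_solvesNear`).
-/

noncomputable section

namespace Samuelson

/-! ### Partial derivatives -/

theorem two_le_infty : (2 : ℕ∞ω) ≤ ∞ := ENat.LEInfty.out

theorem contDiffAt_fderiv_apply {u : ℝ × ℝ → ℝ} {q : ℝ × ℝ} {n m : ℕ∞ω}
    (hu : ContDiffAt ℝ n u q) (hmn : m + 1 ≤ n) (v : ℝ × ℝ) :
    ContDiffAt ℝ m (fun z => fderiv ℝ u z v) q :=
  (hu.fderiv_right hmn).clm_apply contDiffAt_const

theorem partialX_partialY {u : ℝ × ℝ → ℝ} {q : ℝ × ℝ} (hu : ContDiffAt ℝ 2 u q) :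
    partialX (partialY u) q = partialY (partialX u) q := by
  have hd : DifferentiableAt ℝ (fderiv ℝ u) q :=
    (hu.fderiv_right (m := 1) (by norm_num)).differentiableAt (by norm_num)
  have h : ∀ v w : ℝ × ℝ, fderiv ℝ (fun z => fderiv ℝ u z v) q w
      = fderiv ℝ (fderiv ℝ u) q w v := by
    intro v w
    rw [fderiv_clm_apply hd (differentiableAt_const v)]
    simp
  have hs := (hu.isSymmSndFDerivAt (by simp)) (1, 0) (0, 1)
  change fderiv ℝ (fun z => fderiv ℝ u z (0, 1)) q (1, 0)
    = fderiv ℝ (fun z => fderiv ℝ u z (1, 0)) q (0, 1)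
  rw [h, h, hs]

/-- A linear functional on the plane is determined by its coordinates. -/
theorem clm_apply_eq (α : Covector) (v : ℝ × ℝ) : α v = v.1 * α (1, 0) + v.2 * α (0, 1) := by
  have : v = v.1 • ((1, 0) : ℝ × ℝ) + v.2 • ((0, 1) : ℝ × ℝ) := by ext <;> simp
  conv_lhs => rw [this]
  simp only [map_add, map_smul, smul_eq_mul]

namespace Web

variable {W : Web} {p q : ℝ × ℝ} {u v : ℝ × ℝ → ℝ}

/-! ### Nondegeneracy of the web -/

/-- The functions `f_x`, `f_y`, `b` and `b - 1` do not vanish: `ω₁ ∧ ω₂ = f_x f_y dx ∧ dy`,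
`ω₁ ∧ ω₄ = -b ω₁ ∧ ω₂` and `ω₃ ∧ ω₄ = (b - 1) ω₁ ∧ ω₂`. -/
theorem wedge_facts (hq : q ∈ W.U) :
    partialX W.f q ≠ 0 ∧ partialY W.f q ≠ 0 ∧ W.b q ≠ 0 ∧ W.b q - 1 ≠ 0 := by
  have h1 : W.ω₁ q (0, 1) = 0 := by simpa [wedge] using W.ω₁_dx q hq
  have h2 : W.ω₂ q (1, 0) = 0 := by simpa [wedge] using W.ω₂_dy q hq
  obtain ⟨i12, -, i14, -, -, i34⟩ := W.pairwise_independent q hq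
  have n1 : ∀ v, W.ω₃ q v = -W.ω₁ q v - W.ω₂ q v := fun v => by
    have := congrArg (fun α : Covector => α v) (W.normalization₁ q hq)
    simp only [add_apply, zero_apply] at this
    linarith
  have n2 : ∀ v, W.ω₄ q v = -W.ω₁ q v - W.b q * W.ω₂ q v := fun v => by
    have := congrArg (fun α : Covector => α v) (W.normalization₂ q hq)
    simp only [add_apply, zero_apply, smul_apply, smul_eq_mul] at this
    linarith
  have hx : partialX W.f q = -W.ω₁ q (1, 0) := by
    rw [partialX, ← W.ω₃_eq q hq, n1, h2, sub_zero]
  have hy : partialY W.f q = -W.ω₂ q (0, 1) := by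
    rw [partialY, ← W.ω₃_eq q hq, n1, h1]; ring
  simp only [wedge, n1, n2, h1, h2] at i12 i14 i34
  refine ⟨fun h => ?_, fun h => ?_, fun h => ?_, fun h => ?_⟩
  · rw [hx, neg_eq_zero] at h
    simp [h] at i12
  · rw [hy, neg_eq_zero] at h
    simp [h] at i12
  · simp [h] at i14
  · apply i34
    linear_combination (W.ω₁ q (1, 0) * W.ω₂ q (0, 1)) * h

theorem fx_ne (hq : q ∈ W.U) : partialX W.f q ≠ 0 := (wedge_facts hq).1
theorem fy_ne (hq : q ∈ W.U) : partialY W.f q ≠ 0 := (wedge_facts hq).2.1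
theorem b_ne (hq : q ∈ W.U) : W.b q ≠ 0 := (wedge_facts hq).2.2.1
theorem b_sub_one_ne (hq : q ∈ W.U) : W.b q - 1 ≠ 0 := (wedge_facts hq).2.2.2

theorem T₃_ne (hq : q ∈ W.U) : W.T₃ q ≠ 0 := div_ne_zero (b_sub_one_ne hq) (b_ne hq)

theorem eventually_mem (hq : q ∈ W.U) : ∀ᶠ z in 𝓝 q, z ∈ W.U := W.isOpen_U.mem_nhds hq

/-! ### Calculus of the frame derivations -/

theorem D₁_eq (u : ℝ × ℝ → ℝ) (q : ℝ × ℝ) :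
    W.D₁ u q = -(1 / partialX W.f q) * partialX u q := by
  simp only [D₁, frame₁, partialX]; rw [clm_apply_eq]; simp

theorem D₂_eq (u : ℝ × ℝ → ℝ) (q : ℝ × ℝ) :
    W.D₂ u q = -(1 / partialY W.f q) * partialY u q := by
  simp only [D₂, frame₂, partialY]; rw [clm_apply_eq]; simp

/-- The differential `du = u₁ ω₁ + u₂ ω₂`, with `ω₁ = -f_x dx` and `ω₂ = -f_y dy`. -/
theorem fderiv_eq_frame (hq : q ∈ W.U) (u : ℝ × ℝ → ℝ) (e : ℝ × ℝ) :
    fderiv ℝ u q e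
      = -(partialX W.f q * W.D₁ u q) * e.1 - partialY W.f q * W.D₂ u q * e.2 := by
  have hx := fx_ne hq
  have hy := fy_ne hq
  rw [clm_apply_eq, D₁_eq, D₂_eq]
  simp only [partialX, partialY] at *
  field_simp
  ring

theorem D₁_congr (h : u =ᶠ[𝓝 q] v) : W.D₁ u q = W.D₁ v q := by simp only [D₁, h.fderiv_eq]
theorem D₂_congr (h : u =ᶠ[𝓝 q] v) : W.D₂ u q = W.D₂ v q := by simp only [D₂, h.fderiv_eq]

theorem eventuallyEq_D₁ (h : u =ᶠ[𝓝 q] v) : W.D₁ u =ᶠ[𝓝 q] W.D₁ v :=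
  h.eventuallyEq_nhds.mono fun _ hz => D₁_congr hz

@[simp] theorem D₁_const (a : ℝ) : W.D₁ (fun _ => a) q = 0 := by simp [D₁]
@[simp] theorem D₂_const (a : ℝ) : W.D₂ (fun _ => a) q = 0 := by simp [D₂]

theorem D₁_add (hu : DifferentiableAt ℝ u q) (hv : DifferentiableAt ℝ v q) :
    W.D₁ (fun z => u z + v z) q = W.D₁ u q + W.D₁ v q := by
  simp [D₁, fderiv_fun_add hu hv]

theorem D₂_add (hu : DifferentiableAt ℝ u q) (hv : DifferentiableAt ℝ v q) :
    W.D₂ (fun z => u z + v z) q = W.D₂ u q + W.D₂ v q := by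
  simp [D₂, fderiv_fun_add hu hv]

theorem D₁_sub (hu : DifferentiableAt ℝ u q) (hv : DifferentiableAt ℝ v q) :
    W.D₁ (fun z => u z - v z) q = W.D₁ u q - W.D₁ v q := by
  simp [D₁, fderiv_fun_sub hu hv]

theorem D₂_sub (hu : DifferentiableAt ℝ u q) (hv : DifferentiableAt ℝ v q) :
    W.D₂ (fun z => u z - v z) q = W.D₂ u q - W.D₂ v q := by
  simp [D₂, fderiv_fun_sub hu hv]

theorem D₁_mul (hu : DifferentiableAt ℝ u q) (hv : DifferentiableAt ℝ v q) :
    W.D₁ (fun z => u z * v z) q = u q * W.D₁ v q + v q * W.D₁ u q := by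
  simp [D₁, fderiv_fun_mul hu hv]

theorem D₂_mul (hu : DifferentiableAt ℝ u q) (hv : DifferentiableAt ℝ v q) :
    W.D₂ (fun z => u z * v z) q = u q * W.D₂ v q + v q * W.D₂ u q := by
  simp [D₂, fderiv_fun_mul hu hv]

theorem D₁_const_mul (a : ℝ) (hu : DifferentiableAt ℝ u q) :
    W.D₁ (fun z => a * u z) q = a * W.D₁ u q := by
  simp [D₁, fderiv_const_mul hu]

theorem D₂_const_mul (a : ℝ) (hu : DifferentiableAt ℝ u q) :
    W.D₂ (fun z => a * u z) q = a * W.D₂ u q := by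
  simp [D₂, fderiv_const_mul hu]

theorem fderiv_comp_real {w : ℝ → ℝ} (hw : DifferentiableAt ℝ w (u q))
    (hu : DifferentiableAt ℝ u q) (e : ℝ × ℝ) :
    fderiv ℝ (fun z => w (u z)) q e = deriv w (u q) * fderiv ℝ u q e := by
  have h := (hw.hasDerivAt.comp_hasFDerivAt q hu.hasFDerivAt).fderiv
  have h' : (fun z => w (u z)) = w ∘ u := rfl
  rw [h', h]; simp

theorem D₁_comp {w : ℝ → ℝ} (hw : DifferentiableAt ℝ w (u q)) (hu : DifferentiableAt ℝ u q) :
    W.D₁ (fun z => w (u z)) q = deriv w (u q) * W.D₁ u q := fderiv_comp_real hw hu _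

theorem D₂_comp {w : ℝ → ℝ} (hw : DifferentiableAt ℝ w (u q)) (hu : DifferentiableAt ℝ u q) :
    W.D₂ (fun z => w (u z)) q = deriv w (u q) * W.D₂ u q := fderiv_comp_real hw hu _

theorem D₁_inv (hv : DifferentiableAt ℝ v q) (h0 : v q ≠ 0) :
    W.D₁ (fun z => (v z)⁻¹) q = -(W.D₁ v q / v q ^ 2) := by
  rw [D₁_comp (w := fun t => t⁻¹) (differentiableAt_inv h0) hv, deriv_inv]
  ring

theorem D₂_inv (hv : DifferentiableAt ℝ v q) (h0 : v q ≠ 0) :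
    W.D₂ (fun z => (v z)⁻¹) q = -(W.D₂ v q / v q ^ 2) := by
  rw [D₂_comp (w := fun t => t⁻¹) (differentiableAt_inv h0) hv, deriv_inv]
  ring

theorem D₁_f (hq : q ∈ W.U) : W.D₁ W.f q = -1 := by
  have := fx_ne hq
  rw [D₁_eq]; field_simp

theorem D₂_f (hq : q ∈ W.U) : W.D₂ W.f q = -1 := by
  have := fy_ne hq
  rw [D₂_eq]; field_simp

/-! ### Smoothness of the invariants of the web -/

theorem contDiffAt_f (hq : q ∈ W.U) : ContDiffAt ℝ ∞ W.f q :=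
  W.smooth_f.contDiffAt (W.isOpen_U.mem_nhds hq)

theorem contDiffAt_b (hq : q ∈ W.U) : ContDiffAt ℝ ∞ W.b q :=
  W.smooth_b.contDiffAt (W.isOpen_U.mem_nhds hq)

theorem contDiffAt_fx (hq : q ∈ W.U) : ContDiffAt ℝ ∞ (partialX W.f) q :=
  contDiffAt_fderiv_apply (contDiffAt_f hq) le_rfl _

theorem contDiffAt_fy (hq : q ∈ W.U) : ContDiffAt ℝ ∞ (partialY W.f) q :=
  contDiffAt_fderiv_apply (contDiffAt_f hq) le_rfl _

theorem contDiffAt_D₁ {n m : ℕ∞} (hq : q ∈ W.U) (hu : ContDiffAt ℝ n u q) (hmn : m + 1 ≤ n) :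
    ContDiffAt ℝ m (W.D₁ u) q := by
  have h : W.D₁ u = fun z => -(1 / partialX W.f z) * partialX u z := funext (D₁_eq u)
  rw [h]
  exact ((contDiffAt_const.div ((contDiffAt_fx hq).of_le (by exact_mod_cast le_top))
    (fx_ne hq)).neg).mul (contDiffAt_fderiv_apply hu (by exact_mod_cast hmn) _)

theorem contDiffAt_D₂ {n m : ℕ∞} (hq : q ∈ W.U) (hu : ContDiffAt ℝ n u q) (hmn : m + 1 ≤ n) :
    ContDiffAt ℝ m (W.D₂ u) q := by
  have h : W.D₂ u = fun z => -(1 / partialY W.f z) * partialY u z := funext (D₂_eq u)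
  rw [h]
  exact ((contDiffAt_const.div ((contDiffAt_fy hq).of_le (by exact_mod_cast le_top))
    (fy_ne hq)).neg).mul (contDiffAt_fderiv_apply hu (by exact_mod_cast hmn) _)

theorem smooth_D₁ (hq : q ∈ W.U) (hu : ContDiffAt ℝ ∞ u q) : ContDiffAt ℝ ∞ (W.D₁ u) q :=
  contDiffAt_D₁ (n := ⊤) (m := ⊤) hq hu le_rfl

theorem smooth_D₂ (hq : q ∈ W.U) (hu : ContDiffAt ℝ ∞ u q) : ContDiffAt ℝ ∞ (W.D₂ u) q :=
  contDiffAt_D₂ (n := ⊤) (m := ⊤) hq hu le_rfl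

theorem diff_of_smooth (hu : ContDiffAt ℝ ∞ u q) : DifferentiableAt ℝ u q :=
  hu.differentiableAt (by simp)

theorem smooth_H (hq : q ∈ W.U) : ContDiffAt ℝ ∞ W.H q :=
  ContDiffAt.div (contDiffAt_fderiv_apply (contDiffAt_fx hq) le_rfl _)
    ((contDiffAt_fx hq).mul (contDiffAt_fy hq)) (mul_ne_zero (fx_ne hq) (fy_ne hq))

theorem smooth_B (hq : q ∈ W.U) {τ : ℝ × ℝ → ℝ} (hτ : ContDiffAt ℝ ∞ τ q) :
    ContDiffAt ℝ ∞ (W.B τ) q :=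
  (((contDiffAt_const.mul (contDiffAt_b hq)).mul (smooth_H hq)).sub
    (smooth_D₁ hq (contDiffAt_b hq))).sub
      (((contDiffAt_b hq).sub contDiffAt_const).mul (smooth_D₁ hq hτ))

theorem smooth_R (hq : q ∈ W.U) {τ : ℝ × ℝ → ℝ} (hτ : ContDiffAt ℝ ∞ τ q) :
    ContDiffAt ℝ ∞ (W.R τ) q :=
  ((((smooth_D₁ hq (smooth_B hq hτ)).sub (smooth_D₂ hq (smooth_H hq))).add
    ((smooth_H hq).pow 2)).sub ((smooth_H hq).mul (smooth_B hq hτ))).div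
      (contDiffAt_b hq) (b_ne hq)

theorem smooth_r (hq : q ∈ W.U) : ContDiffAt ℝ ∞ W.r q :=
  (smooth_H hq).sub ((smooth_D₁ hq (contDiffAt_b hq)).div (contDiffAt_b hq) (b_ne hq))

theorem smooth_compat₁ (hq : q ∈ W.U) {τ : ℝ × ℝ → ℝ} (hτ : ContDiffAt ℝ ∞ τ q) :
    ContDiffAt ℝ ∞ (W.compat₁ τ) q := by
  have hH := smooth_H hq
  have hr := smooth_r hq
  have hR := smooth_R hq hτ
  exact ((((((smooth_D₂ hq hR).add (hr.mul (smooth_D₁ hq hH))).sub (hr.mul (hH.pow 2))).sub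
    (smooth_D₁ hq (smooth_D₁ hq hH))).add ((contDiffAt_const.mul hH).mul (smooth_D₁ hq hH))).sub
    (hH.pow 3)).sub ((contDiffAt_const.mul hH).mul hR)

theorem smooth_T₃ (hq : q ∈ W.U) : ContDiffAt ℝ ∞ W.T₃ q :=
  ((contDiffAt_b hq).sub contDiffAt_const).div (contDiffAt_b hq) (b_ne hq)

theorem smooth_c (hq : q ∈ W.U) : ContDiffAt ℝ ∞ W.c q :=
  ((smooth_D₁ hq (contDiffAt_b hq)).sub ((smooth_H hq).mul
    ((contDiffAt_b hq).sub contDiffAt_const))).div (contDiffAt_b hq) (b_ne hq)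

theorem smooth_T₂ (hq : q ∈ W.U) : ContDiffAt ℝ ∞ W.T₂ q :=
  (((contDiffAt_const.mul (smooth_H hq)).mul (smooth_T₃ hq)).sub
    (smooth_D₂ hq (smooth_T₃ hq))).sub (smooth_c hq)

theorem smooth_T₁ (hq : q ∈ W.U) : ContDiffAt ℝ ∞ W.T₁ q :=
  (smooth_D₂ hq (smooth_c hq)).sub ((contDiffAt_const.mul (smooth_H hq)).mul (smooth_c hq))

theorem smooth_T₀ (hq : q ∈ W.U) : ContDiffAt ℝ ∞ W.T₀ q :=
  smooth_compat₁ hq contDiffAt_const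

theorem smooth_div_T₃ (hq : q ∈ W.U) (hu : ContDiffAt ℝ ∞ u q) :
    ContDiffAt ℝ ∞ (fun z => u z / W.T₃ z) q :=
  hu.div (smooth_T₃ hq) (T₃_ne hq)

/-! ### Commutation of the frame derivations and the curvature -/

/-- The commutator of the frame derivations is `[∂₁, ∂₂] = H (∂₂ - ∂₁)`. -/
theorem D₁_D₂ (hq : q ∈ W.U) (hu : ContDiffAt ℝ 2 u q) :
    W.D₁ (W.D₂ u) q = W.D₂ (W.D₁ u) q + W.H q * (W.D₂ u q - W.D₁ u q) := by
  have hx := fx_ne hq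
  have hy := fy_ne hq
  have e1 : W.D₁ u = fun z => (-1 * (partialX W.f z)⁻¹) * partialX u z := by
    funext z; rw [D₁_eq]; ring
  have e2 : W.D₂ u = fun z => (-1 * (partialY W.f z)⁻¹) * partialY u z := by
    funext z; rw [D₂_eq]; ring
  have dfx := diff_of_smooth (contDiffAt_fx hq)
  have dfy := diff_of_smooth (contDiffAt_fy hq)
  have dux : DifferentiableAt ℝ (partialX u) q :=
    (contDiffAt_fderiv_apply hu (m := 1) (by norm_num) _).differentiableAt (by norm_num)
  have duy : DifferentiableAt ℝ (partialY u) q :=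
    (contDiffAt_fderiv_apply hu (m := 1) (by norm_num) _).differentiableAt (by norm_num)
  have ix : DifferentiableAt ℝ (fun z => (partialX W.f z)⁻¹) q := dfx.inv hx
  have iy : DifferentiableAt ℝ (fun z => (partialY W.f z)⁻¹) q := dfy.inv hy
  rw [e1, e2, D₁_mul (iy.const_mul _) duy, D₂_mul (ix.const_mul _) dux,
    D₁_const_mul _ iy, D₂_const_mul _ ix, D₁_inv dfy hy, D₂_inv dfx hx,
    D₁_eq (partialY u), D₂_eq (partialX u), D₁_eq (partialY W.f), D₂_eq (partialX W.f),
    partialX_partialY hu,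
    partialX_partialY ((contDiffAt_f hq).of_le two_le_infty), H]
  field_simp
  ring

/-- The curvature is `K = δH`: differentiating `log |f_x|` along `x` and then `y`, and
`log |f_y|` likewise, gives `(H f_y)_x` and `(H f_x)_y`. -/
theorem K_eq (hq : q ∈ W.U) : W.K q = W.D₁ W.H q - W.D₂ W.H q := by
  have hx := fx_ne hq
  have hy := fy_ne hq
  have hne : ∀ᶠ z in 𝓝 q, z ∈ W.U := eventually_mem hq
  have e : partialX (fun z => Real.log (partialX W.f z / partialY W.f z)) =ᶠ[𝓝 q]
      fun z => partialX (partialX W.f) z * (partialX W.f z)⁻¹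
        - partialY (partialX W.f) z * (partialY W.f z)⁻¹ := by
    filter_upwards [hne] with z hz
    have hx := fx_ne hz
    have hy := fy_ne hz
    have dfx := diff_of_smooth (contDiffAt_fx hz)
    have dfy := diff_of_smooth (contDiffAt_fy hz)
    have h1 : (fun z => Real.log (partialX W.f z / partialY W.f z)) =ᶠ[𝓝 z]
        fun z => Real.log (partialX W.f z) - Real.log (partialY W.f z) := by
      filter_upwards [eventually_mem hz] with y hyU
      exact Real.log_div (fx_ne hyU) (fy_ne hyU)
    rw [← partialX_partialY ((contDiffAt_f hz).of_le two_le_infty), partialX, h1.fderiv_eq,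
      fderiv_fun_sub (dfx.log hx) (dfy.log hy), fderiv.log dfx hx, fderiv.log dfy hy]
    simp only [sub_apply, smul_apply, smul_eq_mul]
    simp only [partialX]
    ring
  have sg : ContDiffAt ℝ ∞ (partialY (partialX W.f)) q :=
    contDiffAt_fderiv_apply (contDiffAt_fx hq) le_rfl _
  have dg := diff_of_smooth sg
  have sxx : ContDiffAt ℝ ∞ (partialX (partialX W.f)) q :=
    contDiffAt_fderiv_apply (contDiffAt_fx hq) le_rfl _
  have dxx := diff_of_smooth sxx
  have dfx := diff_of_smooth (contDiffAt_fx hq)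
  have dfy := diff_of_smooth (contDiffAt_fy hq)
  have ix : DifferentiableAt ℝ (fun z => (partialX W.f z)⁻¹) q := dfx.inv hx
  have iy : DifferentiableAt ℝ (fun z => (partialY W.f z)⁻¹) q := dfy.inv hy
  have ixy : DifferentiableAt ℝ (fun z => (partialX W.f z)⁻¹ * (partialY W.f z)⁻¹) q :=
    ix.mul iy
  have eH : W.H = fun z =>
      partialY (partialX W.f) z * ((partialX W.f z)⁻¹ * (partialY W.f z)⁻¹) := by
    funext z
    rw [H, div_eq_mul_inv, mul_inv]
  have hY : ∀ u : ℝ × ℝ → ℝ, partialY u q = -partialY W.f q * W.D₂ u q := fun u => by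
    rw [D₂_eq]; field_simp
  rw [K, hY (partialX _), D₂_congr e, eH, D₁_mul dg ixy, D₂_mul dg ixy,
    D₁_mul ix iy, D₂_mul ix iy,
    D₂_sub (dxx.fun_mul ix) (dg.fun_mul iy), D₂_mul dxx ix, D₂_mul dg iy,
    D₁_inv dfx hx, D₂_inv dfx hx, D₁_inv dfy hy, D₂_inv dfy hy]
  simp only [D₁_eq, D₂_eq]
  rw [← partialX_partialY ((contDiffAt_fx hq).of_le two_le_infty),
    partialX_partialY ((contDiffAt_f hq).of_le two_le_infty)]
  field_simp
  ring

/-- The second compatibility condition compares the curvature with `-δ₂ δ₁ log |b|`. -/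
theorem compat₂_eq_zero_iff (hq : q ∈ W.U) : W.compat₂ q = 0 ↔ W.CurvatureCondition q := by
  have hlog : W.D₁ (fun z => Real.log (W.b z)) =ᶠ[𝓝 q] fun z => W.D₁ W.b z / W.b z := by
    filter_upwards [eventually_mem hq] with z hz
    rw [D₁_comp (w := Real.log) (Real.differentiableAt_log (b_ne hz))
      (diff_of_smooth (contDiffAt_b hz)), Real.deriv_log]
    ring
  have hb : DifferentiableAt ℝ (fun z => W.D₁ W.b z / W.b z) q :=
    diff_of_smooth ((smooth_D₁ hq (contDiffAt_b hq)).div (contDiffAt_b hq) (b_ne hq))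
  have h0 : W.covD₁ 0 (fun z => Real.log (W.b z)) = W.D₁ (fun z => Real.log (W.b z)) := by
    funext z; simp [covD₁]
  have hr : W.D₂ W.r q = W.D₂ W.H q - W.D₂ (fun z => W.D₁ W.b z / W.b z) q :=
    D₂_sub (diff_of_smooth (smooth_H hq)) hb
  rw [CurvatureCondition, h0, covD₂, D₂_congr hlog, hlog.eq_of_nhds, K_eq hq, compat₂, hr, r]
  constructor <;> intro h
  · linear_combination -h
  · linear_combination -h

end Web

/-! ### Functions smooth near a point -/

/-- `u` is smooth at all points of a neighbourhood of `p`. -/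
def SmoothNear {E : Type*} [NormedAddCommGroup E] [NormedSpace ℝ E] (u : E → ℝ) (p : E) : Prop :=
  ∀ᶠ q in 𝓝 p, ContDiffAt ℝ ∞ u q

theorem SmoothNear.self {E : Type*} [NormedAddCommGroup E] [NormedSpace ℝ E] {u : E → ℝ} {p : E}
    (h : SmoothNear u p) : ContDiffAt ℝ ∞ u p := h.self_of_nhds

/-! ### Linear differential equations and Grönwall's inequality -/

/-- A third-order linear ordinary differential equation in normal form with smooth coefficients
has a smooth local solution with arbitrary initial data. -/
theorem exists_solution_linear_ode {φ₀ φ₁ φ₂ : ℝ → ℝ} {t₀ : ℝ} (h₀ : SmoothNear φ₀ t₀)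
    (h₁ : SmoothNear φ₁ t₀) (h₂ : SmoothNear φ₂ t₀) (a₀ a₁ a₂ : ℝ) :
    ∃ w : ℝ → ℝ, SmoothNear w t₀ ∧ w t₀ = a₀ ∧ deriv w t₀ = a₁ ∧ iteratedDeriv 2 w t₀ = a₂ ∧
      ∀ᶠ t in 𝓝 t₀, iteratedDeriv 3 w t
        = -(φ₂ t * iteratedDeriv 2 w t + φ₁ t * deriv w t + φ₀ t) := by
  -- the equation as an autonomous first-order system for `(t, w, w', w'')`
  set V : ℝ × ℝ × ℝ × ℝ → ℝ × ℝ × ℝ × ℝ := fun x =>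
    (1, x.2.2.1, x.2.2.2, -(φ₂ x.1 * x.2.2.2 + φ₁ x.1 * x.2.2.1 + φ₀ x.1)) with hV
  have hVs : ∀ x : ℝ × ℝ × ℝ × ℝ, ContDiffAt ℝ ∞ φ₀ x.1 → ContDiffAt ℝ ∞ φ₁ x.1 →
      ContDiffAt ℝ ∞ φ₂ x.1 → ContDiffAt ℝ ∞ V x := by
    intro x k0 k1 k2
    have f1 : ContDiffAt ℝ ∞ (fun x : ℝ × ℝ × ℝ × ℝ => x.1) x := contDiffAt_fst
    have c0 := k0.comp x f1
    have c1 := k1.comp x f1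
    have c2 := k2.comp x f1
    have f3 : ContDiffAt ℝ ∞ (fun x : ℝ × ℝ × ℝ × ℝ => x.2.2.1) x := by fun_prop
    have f4 : ContDiffAt ℝ ∞ (fun x : ℝ × ℝ × ℝ × ℝ => x.2.2.2) x := by fun_prop
    exact contDiffAt_const.prodMk (f3.prodMk (f4.prodMk
      (((c2.mul f4).add (c1.mul f3)).add c0).neg))
  obtain ⟨α, hα0, ε, hε, hα⟩ :=
    ((hVs (t₀, a₀, a₁, a₂) h₀.self h₁.self h₂.self).of_le
      (m := 1) (by simp)).exists_forall_mem_closedBall_exists_eq_forall_mem_Ioo_hasDerivAt₀ t₀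
  have hcont : ContinuousAt α t₀ := (hα t₀ ⟨by linarith, by linarith⟩).continuousAt
  have hgood : ∀ᶠ t in 𝓝 t₀, ContDiffAt ℝ ∞ V (α t) := by
    have : Tendsto (fun t => (α t).1) (𝓝 t₀) (𝓝 t₀) := by
      have := (continuous_fst.continuousAt.comp hcont).tendsto
      simpa [Function.comp_def, hα0] using this
    filter_upwards [this.eventually h₀, this.eventually h₁, this.eventually h₂] with t k0 k1 k2
    exact hVs _ k0 k1 k2
  obtain ⟨η, hη, hball⟩ := Metric.eventually_nhds_iff.1 hgood
  set ρ := min ε η / 2 with hρ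
  have hρ0 : 0 < ρ := by positivity
  have hρε : ρ < ε := by have := min_le_left ε η; rw [hρ]; linarith [lt_min hε hη]
  have hρη : ρ < η := by have := min_le_right ε η; rw [hρ]; linarith [lt_min hε hη]
  have hd : ∀ t ∈ Set.Icc (t₀ - ρ) (t₀ + ρ), HasDerivAt α (V (α t)) t := fun t ht =>
    hα t ⟨by linarith [ht.1], by linarith [ht.2]⟩
  have hsm : ∀ t ∈ Set.Icc (t₀ - ρ) (t₀ + ρ), ContDiffAt ℝ ∞ V (α t) := fun t ht =>
    hball (by rw [Real.dist_eq, abs_lt]; constructor <;> linarith [ht.1, ht.2])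
  have hαs : ContDiffOn ℝ ∞ α (Set.Icc (t₀ - ρ) (t₀ + ρ)) := by
    refine ODE.contDiffOn_enat_Icc_of_hasDerivWithinAt (n := ⊤) (f := fun _ => V)
      (u := {x | ContDiffAt ℝ ∞ V x}) ?_ (fun t ht => (hd t ht).hasDerivWithinAt) hsm
    intro x hx
    have hx2 : ContDiffAt ℝ ∞ V x.2 := hx.2
    exact (ContDiffAt.comp x (f := Prod.snd) hx2 contDiffAt_snd).contDiffWithinAt
  have hI : ∀ t ∈ Set.Ioo (t₀ - ρ) (t₀ + ρ), ContDiffAt ℝ ∞ α t := fun t ht =>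
    hαs.contDiffAt (Icc_mem_nhds ht.1 ht.2)
  have htI : t₀ ∈ Set.Ioo (t₀ - ρ) (t₀ + ρ) := ⟨by linarith, by linarith⟩
  have hnI : Set.Ioo (t₀ - ρ) (t₀ + ρ) ∈ 𝓝 t₀ := Ioo_mem_nhds htI.1 htI.2
  have hd' : ∀ t ∈ Set.Ioo (t₀ - ρ) (t₀ + ρ), HasDerivAt α (V (α t)) t := fun t ht =>
    hd t ⟨ht.1.le, ht.2.le⟩
  -- the first component of the integral curve is the time
  have htime : ∀ t ∈ Set.Ioo (t₀ - ρ) (t₀ + ρ), (α t).1 = t := by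
    intro t ht
    have h1 : ∀ s ∈ Set.Ioo (t₀ - ρ) (t₀ + ρ), HasDerivAt (fun s => (α s).1 - s) 0 s := by
      intro s hs
      have h : HasDerivAt (fun s => (α s).1) 1 s := (hd' s hs).fst
      simpa using h.fun_sub (hasDerivAt_id' s)
    have := isOpen_Ioo.is_const_of_deriv_eq_zero isPreconnected_Ioo
      (fun s hs => (h1 s hs).differentiableAt.differentiableWithinAt)
      (fun s hs => (h1 s hs).deriv) ht htI
    simp only [hα0] at this
    linarith
  have w1 : ∀ t ∈ Set.Ioo (t₀ - ρ) (t₀ + ρ),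
      HasDerivAt (fun s => (α s).2.1) (α t).2.2.1 t := fun t ht => (hd' t ht).snd.fst
  have w2 : ∀ t ∈ Set.Ioo (t₀ - ρ) (t₀ + ρ),
      HasDerivAt (fun s => (α s).2.2.1) (α t).2.2.2 t := fun t ht => (hd' t ht).snd.snd.fst
  have w3 : ∀ t ∈ Set.Ioo (t₀ - ρ) (t₀ + ρ), HasDerivAt (fun s => (α s).2.2.2)
      (-(φ₂ t * (α t).2.2.2 + φ₁ t * (α t).2.2.1 + φ₀ t)) t := fun t ht => by
    have h : HasDerivAt (fun s => (α s).2.2.2) (V (α t)).2.2.2 t := (hd' t ht).snd.snd.snd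
    simpa only [hV, htime t ht] using h
  have d1 : ∀ t ∈ Set.Ioo (t₀ - ρ) (t₀ + ρ), deriv (fun s => (α s).2.1) t = (α t).2.2.1 :=
    fun t ht => (w1 t ht).deriv
  have d2 : ∀ t ∈ Set.Ioo (t₀ - ρ) (t₀ + ρ),
      iteratedDeriv 2 (fun s => (α s).2.1) t = (α t).2.2.2 := fun t ht => by
    rw [iteratedDeriv_succ, iteratedDeriv_one]
    rw [Filter.EventuallyEq.deriv_eq (f := fun s => (α s).2.2.1)
      (eventually_of_mem (isOpen_Ioo.mem_nhds ht) d1)]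
    exact (w2 t ht).deriv
  refine ⟨fun s => (α s).2.1, ?_, by simp [hα0], by simp [d1 t₀ htI, hα0], by
    simp [d2 t₀ htI, hα0], ?_⟩
  · filter_upwards [hnI] with t ht
    exact (hI t ht).snd.fst
  · filter_upwards [hnI] with t ht
    rw [d1 t ht, d2 t ht, iteratedDeriv_succ, Filter.EventuallyEq.deriv_eq
      (f := fun s => (α s).2.2.2) (eventually_of_mem (isOpen_Ioo.mem_nhds ht) d2)]
    exact (w3 t ht).deriv

/-- Grönwall's inequality along the segments issuing from `p`. -/
theorem eventually_eq_zero_of_norm_fderiv_le {E F : Type*} [NormedAddCommGroup E]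
    [NormedSpace ℝ E] [NormedAddCommGroup F] [NormedSpace ℝ F] {u : E → F} {p : E} {C : ℝ}
    (hd : ∀ᶠ q in 𝓝 p, DifferentiableAt ℝ u q)
    (h : ∀ᶠ q in 𝓝 p, ‖fderiv ℝ u q‖ ≤ C * ‖u q‖) (h0 : u p = 0) : ∀ᶠ q in 𝓝 p, u q = 0 := by
  obtain ⟨ε, hε, hb⟩ := Metric.eventually_nhds_iff_ball.1 (hd.and h)
  filter_upwards [Metric.ball_mem_nhds p hε] with q hq
  set γ : ℝ → E := fun t => p + t • (q - p) with hγ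
  have hγd : ∀ t, HasDerivAt γ (q - p) t := fun t => by
    simpa [hγ] using ((hasDerivAt_id' t).smul_const (q - p)).const_add p
  have hmem : ∀ t ∈ Set.Icc (0 : ℝ) 1, γ t ∈ Metric.ball p ε := by
    intro t ht
    have := (convex_ball p ε).add_smul_sub_mem (Metric.mem_ball_self hε) hq ht
    simpa [hγ] using this
  have hcomp : ∀ t ∈ Set.Icc (0 : ℝ) 1,
      HasDerivAt (fun s => u (γ s)) (fderiv ℝ u (γ t) (q - p)) t := fun t ht =>
    ((hb _ (hmem t ht)).1.hasFDerivAt).comp_hasDerivAt t (hγd t)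
  have := eq_zero_of_abs_deriv_le_mul_abs_self_of_eq_zero_right (f := fun s => u (γ s))
    (f' := fun t => fderiv ℝ u (γ t) (q - p)) (K := C * ‖q - p‖) (a := 0) (b := 1)
    (fun t ht => (hcomp t ht).continuousAt.continuousWithinAt)
    (fun t ht => (hcomp t ⟨ht.1, ht.2.le⟩).hasDerivWithinAt) (by simp [hγ, h0])
    (fun t ht => by
      have h1 := (hb _ (hmem t ⟨ht.1, ht.2.le⟩)).2
      calc ‖fderiv ℝ u (γ t) (q - p)‖ ≤ ‖fderiv ℝ u (γ t)‖ * ‖q - p‖ :=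
            ContinuousLinearMap.le_opNorm _ _
        _ ≤ C * ‖u (γ t)‖ * ‖q - p‖ := by gcongr
        _ = C * ‖q - p‖ * ‖u (γ t)‖ := by ring)
    1 ⟨zero_le_one, le_rfl⟩
  simpa [hγ] using this

namespace Web

variable {W : Web} {p q : ℝ × ℝ} {u v : ℝ × ℝ → ℝ}

/-- Functions which vanish at `p` and satisfy a linear system expressing all their frame
derivatives vanish near `p`. -/
theorem eventually_eq_zero_of_frame_le {ι : Type*} [Fintype ι] (hp : p ∈ W.U)
    {u : ι → ℝ × ℝ → ℝ} (hu : ∀ i, SmoothNear (u i) p) {C : ℝ}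
    (h : ∀ i, ∀ᶠ q in 𝓝 p, |W.D₁ (u i) q| ≤ C * ‖fun j => u j q‖ ∧
      |W.D₂ (u i) q| ≤ C * ‖fun j => u j q‖) (h0 : ∀ i, u i p = 0) (i : ι) :
    ∀ᶠ q in 𝓝 p, u i q = 0 := by
  have hx : ∀ᶠ q in 𝓝 p, |partialX W.f q| < |partialX W.f p| + 1 :=
    ((contDiffAt_fx hp).continuousAt.abs).eventually_lt continuousAt_const (by linarith)
  have hy : ∀ᶠ q in 𝓝 p, |partialY W.f q| < |partialY W.f p| + 1 :=
    ((contDiffAt_fy hp).continuousAt.abs).eventually_lt continuousAt_const (by linarith)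
  set M := |partialX W.f p| + 1 + (|partialY W.f p| + 1) with hM
  have hdiff : ∀ᶠ q in 𝓝 p, ∀ i, ContDiffAt ℝ ∞ (u i) q := eventually_all.2 hu
  have key : ∀ᶠ q in 𝓝 p, (fun j => u j q) = 0 := by
    refine eventually_eq_zero_of_norm_fderiv_le (u := fun q j => u j q) (C := M * C) ?_ ?_
      (funext h0)
    · filter_upwards [hdiff] with q hq
      exact differentiableAt_pi.2 fun i => diff_of_smooth (hq i)
    · filter_upwards [hdiff, hx, hy, eventually_all.2 h, eventually_mem hp] with q hq hx hy h hqU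
      refine ContinuousLinearMap.opNorm_le_bound' _ ?_ fun e _ => ?_
      · by_cases hi : IsEmpty ι
        · have : (fun j => u j q) = 0 := Subsingleton.elim _ _
          simp [this]
        · obtain ⟨i⟩ := not_isEmpty_iff.1 hi
          have := (abs_nonneg _).trans (h i).1
          have hM0 : 0 ≤ M := by positivity
          rw [mul_assoc]
          positivity
      · have hC : ∀ i, 0 ≤ C * ‖fun j => u j q‖ := fun i => (abs_nonneg _).trans (h i).1
        have hcoord : ∀ i, (fderiv ℝ (fun q j => u j q) q e) i = fderiv ℝ (u i) q e := by
          intro i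
          rw [fderiv_pi fun i => diff_of_smooth (hq i)]
          simp
        by_cases hi : IsEmpty ι
        · have h1 : fderiv ℝ (fun q j => u j q) q e = 0 := Subsingleton.elim _ _
          have h2 : (fun j => u j q) = 0 := Subsingleton.elim _ _
          simp [h1, h2]
        have hi' := not_isEmpty_iff.1 hi
        refine (pi_norm_le_iff_of_nonempty _).2 fun i => ?_
        rw [hcoord, fderiv_eq_frame hqU, Real.norm_eq_abs]
        have e1 : |e.1| ≤ ‖e‖ := norm_fst_le e
        have e2 : |e.2| ≤ ‖e‖ := norm_snd_le e
        set N := C * ‖fun j => u j q‖ with hN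
        have hN0 : 0 ≤ N := hC i
        calc |-(partialX W.f q * W.D₁ (u i) q) * e.1 - partialY W.f q * W.D₂ (u i) q * e.2|
            ≤ |-(partialX W.f q * W.D₁ (u i) q) * e.1| + |partialY W.f q * W.D₂ (u i) q * e.2| :=
              abs_sub _ _
          _ = |partialX W.f q| * |W.D₁ (u i) q| * |e.1|
              + |partialY W.f q| * |W.D₂ (u i) q| * |e.2| := by
              simp only [abs_mul, abs_neg]
          _ ≤ (|partialX W.f p| + 1) * N * ‖e‖ + (|partialY W.f p| + 1) * N * ‖e‖ := by
              gcongr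
              · exact (h i).1
              · exact (h i).2
          _ = M * C * ‖fun j => u j q‖ * ‖e‖ := by rw [hM, hN]; ring
  filter_upwards [key] with q hq
  exact congrFun hq i

/-! ### Primitives of closed forms and functions of `f` -/

theorem D₂_fx (hq : q ∈ W.U) : W.D₂ (partialX W.f) q = -(W.H q * partialX W.f q) := by
  have hx := fx_ne hq
  have hy := fy_ne hq
  rw [D₂_eq, H]; field_simp

theorem D₁_fy (hq : q ∈ W.U) : W.D₁ (partialY W.f) q = -(W.H q * partialY W.f q) := by
  have hx := fx_ne hq
  have hy := fy_ne hq
  rw [D₁_eq, H, partialX_partialY ((contDiffAt_f hq).of_le two_le_infty)]; field_simp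

/-- The Poincaré lemma in the frame `∂₁, ∂₂`: the 1-form `g₁ ω₁ + g₂ ω₂` has a primitive near `p`
when it is closed. -/
theorem exists_primitive (hp : p ∈ W.U) {g₁ g₂ : ℝ × ℝ → ℝ} (h₁ : SmoothNear g₁ p)
    (h₂ : SmoothNear g₂ p)
    (h : ∀ᶠ q in 𝓝 p, W.D₁ g₂ q = W.D₂ g₁ q + W.H q * (g₂ q - g₁ q)) (a : ℝ) :
    ∃ u, SmoothNear u p ∧ u p = a ∧ ∀ᶠ q in 𝓝 p, W.D₁ u q = g₁ q ∧ W.D₂ u q = g₂ q := by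
  obtain ⟨ε, hε, hb⟩ := Metric.eventually_nhds_iff_ball.1
    (((eventually_mem hp).and h).and (h₁.and h₂))
  -- the coefficients of `dx` and `dy`: `ω₁ = -f_x dx` and `ω₂ = -f_y dy`
  set P : ℝ × ℝ → ℝ := fun q => -1 * (partialX W.f q * g₁ q) with hP
  set Q : ℝ × ℝ → ℝ := fun q => -1 * (partialY W.f q * g₂ q) with hQ
  set α : ℝ × ℝ → Covector := fun q =>
    P q • ContinuousLinearMap.fst ℝ ℝ ℝ + Q q • ContinuousLinearMap.snd ℝ ℝ ℝ with hα
  have sP : ∀ q ∈ Metric.ball p ε, ContDiffAt ℝ ∞ P q := fun q hq =>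
    contDiffAt_const.mul ((contDiffAt_fx (hb q hq).1.1).mul (hb q hq).2.1)
  have sQ : ∀ q ∈ Metric.ball p ε, ContDiffAt ℝ ∞ Q q := fun q hq =>
    contDiffAt_const.mul ((contDiffAt_fy (hb q hq).1.1).mul (hb q hq).2.2)
  have sα : ∀ q ∈ Metric.ball p ε, ContDiffAt ℝ ∞ α q := fun q hq =>
    ((sP q hq).smul contDiffAt_const).add ((sQ q hq).smul contDiffAt_const)
  have hcl : ∀ q ∈ Metric.ball p ε, ∀ x y, fderiv ℝ α q x y = fderiv ℝ α q y x := by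
    intro q hq x y
    have hqU := (hb q hq).1.1
    have hx := fx_ne hqU
    have hy := fy_ne hqU
    have dP := diff_of_smooth (sP q hq)
    have dQ := diff_of_smooth (sQ q hq)
    have d1 := diff_of_smooth (hb q hq).2.1
    have d2 := diff_of_smooth (hb q hq).2.2
    have dfx := diff_of_smooth (contDiffAt_fx hqU)
    have dfy := diff_of_smooth (contDiffAt_fy hqU)
    have hder : fderiv ℝ α q = (fderiv ℝ P q).smulRight (ContinuousLinearMap.fst ℝ ℝ ℝ)
        + (fderiv ℝ Q q).smulRight (ContinuousLinearMap.snd ℝ ℝ ℝ) :=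
      ((dP.hasFDerivAt.smul_const _).add (dQ.hasFDerivAt.smul_const _)).fderiv
    have e1 : W.D₂ P q = -(partialX W.f q * W.D₂ g₁ q - g₁ q * (W.H q * partialX W.f q)) := by
      rw [hP, D₂_const_mul _ (dfx.fun_mul d1), D₂_mul dfx d1, D₂_fx hqU]; ring
    have e2 : W.D₁ Q q = -(partialY W.f q * W.D₁ g₂ q - g₂ q * (W.H q * partialY W.f q)) := by
      rw [hQ, D₁_const_mul _ (dfy.fun_mul d2), D₁_mul dfy d2, D₁_fy hqU]; ring
    have h' := (hb q hq).1.2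
    rw [hder]
    simp only [add_apply, ContinuousLinearMap.smulRight_apply, smul_apply,
      ContinuousLinearMap.coe_fst', ContinuousLinearMap.coe_snd', smul_eq_mul]
    rw [fderiv_eq_frame hqU P, fderiv_eq_frame hqU P, fderiv_eq_frame hqU Q,
      fderiv_eq_frame hqU Q, e1, e2, h']
    ring
  obtain ⟨F, hF⟩ := (convex_ball p ε).exists_forall_hasFDerivAt_of_fderiv_symmetric
    Metric.isOpen_ball (fun q hq => ((sα q hq).differentiableAt (by simp)).differentiableWithinAt)
    hcl
  have sF : ContDiffOn ℝ ∞ F (Metric.ball p ε) := by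
    refine (contDiffOn_infty_iff_fderiv_of_isOpen Metric.isOpen_ball).2
      ⟨fun q hq => (hF q hq).differentiableAt.differentiableWithinAt, fun q hq => ?_⟩
    refine (sα q hq).contDiffWithinAt.congr (fun z hz => (hF z hz).fderiv) (hF q hq).fderiv
  have hnb : Metric.ball p ε ∈ 𝓝 p := Metric.ball_mem_nhds p hε
  refine ⟨fun q => F q + (a - F p), ?_, by ring, ?_⟩
  · filter_upwards [hnb] with q hq
    exact (sF.contDiffAt (Metric.isOpen_ball.mem_nhds hq)).add contDiffAt_const
  · filter_upwards [hnb] with q hq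
    have hd : fderiv ℝ (fun q => F q + (a - F p)) q = α q := ((hF q hq).add_const _).fderiv
    have hx := fx_ne (hb q hq).1.1
    have hy := fy_ne (hb q hq).1.1
    constructor
    · have e : partialX (fun q => F q + (a - F p)) q = P q := by rw [partialX, hd]; simp [hα]
      rw [D₁_eq, e, hP]; field_simp
    · have e : partialY (fun q => F q + (a - F p)) q = Q q := by rw [partialY, hd]; simp [hα]
      rw [D₂_eq, e, hQ]; field_simp

/-- The level curves of `f` are the integral curves of `δ`: a function annihilated by `δ` is
locally a smooth function of `f`. -/
theorem exists_eq_comp_f (hp : p ∈ W.U) (hu : SmoothNear u p) (hδ : ∀ᶠ q in 𝓝 p, W.δ u q = 0) :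
    ∃ φ : ℝ → ℝ, SmoothNear φ (W.f p) ∧ ∀ᶠ q in 𝓝 p, u q = φ (W.f q) := by
  -- `(f, y)` are local coordinates
  set F : ℝ × ℝ → ℝ × ℝ := fun q => (W.f q, q.2) with hFdef
  have sF : ∀ q ∈ W.U, ContDiffAt ℝ ∞ F q := fun q hq => (contDiffAt_f hq).prodMk contDiffAt_snd
  have hF' : ∀ q ∈ W.U, HasFDerivAt F ((fderiv ℝ W.f q).prod (ContinuousLinearMap.snd ℝ ℝ ℝ)) q :=
    fun q hq => (diff_of_smooth (contDiffAt_f hq)).hasFDerivAt.prodMk hasFDerivAt_snd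
  have hFe : ∀ q ∈ W.U, ∃ e : (ℝ × ℝ) ≃L[ℝ] (ℝ × ℝ),
      HasFDerivAt F (e : (ℝ × ℝ) →L[ℝ] (ℝ × ℝ)) q := by
    intro q hq
    have hx := fx_ne hq
    refine ⟨ContinuousLinearEquiv.equivOfInverse
      ((fderiv ℝ W.f q).prod (ContinuousLinearMap.snd ℝ ℝ ℝ))
      (((partialX W.f q)⁻¹ • (ContinuousLinearMap.fst ℝ ℝ ℝ
        - partialY W.f q • ContinuousLinearMap.snd ℝ ℝ ℝ)).prod (ContinuousLinearMap.snd ℝ ℝ ℝ))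
      (fun e => ?_) (fun e => ?_), hF' q hq⟩
    · ext
      · simp only [ContinuousLinearMap.prod_apply, smul_apply, sub_apply, smul_eq_mul,
          ContinuousLinearMap.coe_fst', ContinuousLinearMap.coe_snd']
        rw [clm_apply_eq]
        change (partialX W.f q)⁻¹ * (e.1 * partialX W.f q + e.2 * partialY W.f q
          - partialY W.f q * e.2) = e.1
        field_simp; ring
      · simp
    · ext
      · simp only [ContinuousLinearMap.prod_apply, smul_apply, sub_apply, smul_eq_mul,
          ContinuousLinearMap.coe_fst', ContinuousLinearMap.coe_snd']
        rw [clm_apply_eq]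
        change (partialX W.f q)⁻¹ * (e.1 - partialY W.f q * e.2) * partialX W.f q
          + e.2 * partialY W.f q = e.1
        field_simp; ring
      · simp
  obtain ⟨e, he⟩ := hFe p hp
  have hn0 : (∞ : ℕ∞ω) ≠ 0 := by simp
  set Φ := (sF p hp).toOpenPartialHomeomorph F he hn0 with hΦ
  have hΦc : (Φ : ℝ × ℝ → ℝ × ℝ) = F := rfl
  have hps : p ∈ Φ.source := (sF p hp).mem_toOpenPartialHomeomorph_source he hn0
  have hpt : F p ∈ Φ.target := (sF p hp).image_mem_toOpenPartialHomeomorph_target he hn0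
  have hG : Tendsto Φ.symm (𝓝 (F p)) (𝓝 p) := by
    have h1 := (Φ.symm.continuousAt (x := F p) hpt).tendsto
    have h2 : Φ.symm (F p) = p := Φ.left_inv hps
    rwa [h2] at h1
  have htgt : ∀ᶠ z in 𝓝 (F p), z ∈ Φ.target := Φ.open_target.mem_nhds hpt
  have hsrc : ∀ᶠ q in 𝓝 p, q ∈ Φ.source := Φ.open_source.mem_nhds hps
  set k : ℝ × ℝ → ℝ := fun z => u (Φ.symm z) with hk
  have sk : SmoothNear k (F p) := by
    filter_upwards [htgt, hG.eventually hu, hG.eventually (eventually_mem hp)] with z hz huz hzU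
    obtain ⟨e', he'⟩ := hFe _ hzU
    exact ContDiffAt.comp z huz (Φ.contDiffAt_symm hz he' (sF _ hzU))
  -- in these coordinates `δ` is a nonvanishing multiple of `∂/∂y`
  have hky : ∀ᶠ z in 𝓝 (F p), fderiv ℝ k z (0, 1) = 0 := by
    filter_upwards [htgt, hG.eventually (hsrc.eventually_nhds), hG.eventually (eventually_mem hp),
      hG.eventually hδ, sk] with z hz hs hqU hδq hkz
    set q := Φ.symm z with hq
    have hFq : F q = z := Φ.right_inv hz
    have hukF : u =ᶠ[𝓝 q] k ∘ F := by
      filter_upwards [hs] with q' hq'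
      have : Φ.symm (F q') = q' := Φ.left_inv hq'
      simp [hk, this]
    have hdk : HasFDerivAt k (fderiv ℝ k z) (F q) := by
      rw [hFq]; exact (diff_of_smooth hkz).hasFDerivAt
    have hdu := hukF.fderiv_eq.trans (hdk.comp q (hF' q hqU)).fderiv
    have hy := fy_ne hqU
    have d1 : W.D₁ u q = fderiv ℝ k z (-1, 0) := by
      have h1 : fderiv ℝ W.f q (W.frame₁ q) = -1 := D₁_f hqU
      simp only [D₁, hdu, ContinuousLinearMap.comp_apply, ContinuousLinearMap.prod_apply, h1]
      simp [frame₁]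
    have d2 : W.D₂ u q = fderiv ℝ k z (-1, -(1 / partialY W.f q)) := by
      have h1 : fderiv ℝ W.f q (W.frame₂ q) = -1 := D₂_f hqU
      simp only [D₂, hdu, ContinuousLinearMap.comp_apply, ContinuousLinearMap.prod_apply, h1]
      simp [frame₂]
    rw [δ, d1, d2, clm_apply_eq, clm_apply_eq (fderiv ℝ k z) (-1, -(1 / partialY W.f q))] at hδq
    simp only at hδq
    field_simp at hδq
    linarith
  obtain ⟨ε, hε, hb⟩ := Metric.eventually_nhds_iff_ball.1 (sk.and hky)
  have hkc : ∀ z ∈ Metric.ball (F p) ε, k z = k (z.1, p.2) := by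
    intro z hz
    rw [← ball_prod_same] at hz hb
    have hz' := Set.mem_prod.1 hz
    have hline : ∀ y ∈ Metric.ball p.2 ε, HasDerivAt (fun y => k (z.1, y)) 0 y := by
      intro y hy
      obtain ⟨hs, h0⟩ := hb (z.1, y) (Set.mk_mem_prod hz'.1 hy)
      have hc : HasDerivAt (fun y : ℝ => (z.1, y)) ((0, 1) : ℝ × ℝ) y :=
        (hasDerivAt_const y z.1).prodMk (hasDerivAt_id y)
      have := (diff_of_smooth hs).hasFDerivAt.comp_hasDerivAt y hc
      rwa [h0] at this
    exact Metric.isOpen_ball.is_const_of_deriv_eq_zero (convex_ball p.2 ε).isPreconnected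
      (fun y hy => (hline y hy).differentiableAt.differentiableWithinAt)
      (fun y hy => (hline y hy).deriv) hz'.2 (Metric.mem_ball_self hε)
  refine ⟨fun t => k (t, p.2), ?_, ?_⟩
  · have ht : Tendsto (fun t : ℝ => (t, p.2)) (𝓝 (W.f p)) (𝓝 (F p)) :=
      (Continuous.prodMk_left p.2).tendsto (W.f p)
    filter_upwards [ht.eventually sk] with t hkt
    exact ContDiffAt.comp (g := k) t hkt (contDiffAt_id.prodMk contDiffAt_const)
  · have hFc : Tendsto F (𝓝 p) (𝓝 (F p)) := (sF p hp).continuousAt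
    filter_upwards [hsrc, hFc.eventually (Metric.ball_mem_nhds _ hε)] with q hq hqb
    have h1 : k (F q) = u q := by
      have : Φ.symm (F q) = q := Φ.left_inv hq
      simp [hk, this]
    rw [← h1, hkc _ hqb]

end Web

theorem contDiffAt_deriv {w : ℝ → ℝ} {t : ℝ} {n m : ℕ∞ω} (hw : ContDiffAt ℝ n w t)
    (hmn : m + 1 ≤ n) : ContDiffAt ℝ m (deriv w) t := by
  have h : deriv w = fun s => fderiv ℝ w s 1 := funext fun s => (fderiv_apply_one_eq_deriv).symm
  rw [h]
  exact (hw.fderiv_right hmn).clm_apply contDiffAt_const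

namespace Web

variable {W : Web} {p q : ℝ × ℝ} {u v : ℝ × ℝ → ℝ}

/-! ### The first compatibility condition as a differential equation for `τ₁` -/

/-- The first compatibility condition in terms of `v = ∂₁τ` and `a = ∂₁v`, when `∂₂v = a`. -/
theorem compat₁_eq (hq : q ∈ W.U) {τ a : ℝ × ℝ → ℝ} (hv : W.D₁ τ =ᶠ[𝓝 q] v)
    (ha : W.D₁ v =ᶠ[𝓝 q] a) (hvd : ∀ᶠ z in 𝓝 q, DifferentiableAt ℝ v z)
    (had : DifferentiableAt ℝ a q) (h2 : W.D₂ v q = a q) :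
    W.compat₁ τ q = W.T₀ q - W.T₁ q * v q + W.T₂ q * a q - W.T₃ q * W.D₂ a q := by
  set B₀ := W.B (fun _ => 0) with hB₀
  set R₀ := W.R (fun _ => 0) with hR₀
  have eB : W.B τ =ᶠ[𝓝 q] fun z => B₀ z - (W.b z - 1) * v z := by
    filter_upwards [hv] with z hz
    simp only [B, hz, hB₀, D₁_const]; ring
  have eR : W.R τ =ᶠ[𝓝 q] fun z => R₀ z - (W.c z * v z + W.T₃ z * a z) := by
    filter_upwards [eB.eventuallyEq_nhds, ha, hvd, eventually_mem hq] with z hz ha hvd hzU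
    have dB := diff_of_smooth (smooth_B (W := W) hzU (τ := fun _ => 0) contDiffAt_const)
    have db := diff_of_smooth (contDiffAt_b hzU)
    have db1 : DifferentiableAt ℝ (fun z => W.b z - 1) z := db.sub_const 1
    have hb := b_ne hzU
    have e1 : W.D₁ (fun z => W.b z - 1) z = W.D₁ W.b z := by
      rw [D₁_sub db (differentiableAt_const 1)]; simp
    have e2 : W.D₁ (W.B τ) z = W.D₁ B₀ z - ((W.b z - 1) * a z + v z * W.D₁ W.b z) := by
      rw [D₁_congr hz, D₁_sub dB (db1.fun_mul hvd), D₁_mul db1 hvd, e1, ha]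
    have e3 : W.B τ z = B₀ z - (W.b z - 1) * v z := hz.eq_of_nhds
    simp only [R, e2, e3, hR₀, c, T₃, ← hB₀]
    field_simp
    ring
  have dR := diff_of_smooth (smooth_R (W := W) hq (τ := fun _ => 0) contDiffAt_const)
  have dv := hvd.self_of_nhds
  have dc := diff_of_smooth (smooth_c hq)
  have dT := diff_of_smooth (smooth_T₃ hq)
  have eD : W.D₂ (W.R τ) q = W.D₂ R₀ q
      - (W.c q * a q + v q * W.D₂ W.c q + (W.T₃ q * W.D₂ a q + a q * W.D₂ W.T₃ q)) := by
    rw [D₂_congr eR, D₂_sub dR ((dc.fun_mul dv).fun_add (dT.fun_mul had)),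
      D₂_add (dc.fun_mul dv) (dT.fun_mul had), D₂_mul dc dv, D₂_mul dT had, h2]
  simp only [compat₁, eD, eR.eq_of_nhds, T₀, T₁, T₂, ← hR₀]
  ring

/-- The derivatives of a function of `f`: since `∂₁f = ∂₂f = -1`, each frame derivation acts on it
as `-d/dt`. -/
theorem D_comp_f (hq : q ∈ W.U) {w : ℝ → ℝ} (hw : DifferentiableAt ℝ w (W.f q)) :
    W.D₁ (fun z => w (W.f z)) q = -deriv w (W.f q) ∧
    W.D₂ (fun z => w (W.f z)) q = -deriv w (W.f q) := by
  have df := diff_of_smooth (contDiffAt_f hq)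
  rw [D₁_comp hw df, D₂_comp hw df, D₁_f hq, D₂_f hq]
  exact ⟨by ring, by ring⟩

theorem tendsto_f (hq : q ∈ W.U) : Tendsto W.f (𝓝 q) (𝓝 (W.f q)) :=
  (contDiffAt_f hq).continuousAt

theorem D₁_neg (hu : DifferentiableAt ℝ u q) : W.D₁ (fun z => -u z) q = -W.D₁ u q := by
  simpa using D₁_const_mul (W := W) (-1) hu

theorem D₂_neg (hu : DifferentiableAt ℝ u q) : W.D₂ (fun z => -u z) q = -W.D₂ u q := by
  simpa using D₂_const_mul (W := W) (-1) hu

/-- The first compatibility condition for `τ₁ = w(f)` is a third-order ordinary differential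
equation for `w`. -/
theorem compat₁_comp_f (hq : q ∈ W.U) {w : ℝ → ℝ} (hw : ContDiffAt ℝ ∞ w (W.f q)) :
    W.compat₁ (fun z => w (W.f z)) q =
      W.T₃ q * iteratedDeriv 3 w (W.f q) + W.T₂ q * iteratedDeriv 2 w (W.f q)
        + W.T₁ q * deriv w (W.f q) + W.T₀ q := by
  have e2 : iteratedDeriv 2 w = deriv (deriv w) := by rw [iteratedDeriv_succ, iteratedDeriv_one]
  have e3 : iteratedDeriv 3 w = deriv (deriv (deriv w)) := by rw [iteratedDeriv_succ, e2]
  rw [e2, e3]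
  have h3 : ContDiffAt ℝ 3 w (W.f q) := hw.of_le ENat.LEInfty.out
  have hev : ∀ᶠ z in 𝓝 q, ContDiffAt ℝ 3 w (W.f z) :=
    (tendsto_f hq).eventually (h3.eventually (by simp))
  have c1 : ∀ {t}, ContDiffAt ℝ 3 w t → ContDiffAt ℝ 2 (deriv w) t := fun h =>
    contDiffAt_deriv h (by norm_num)
  have c2 : ∀ {t}, ContDiffAt ℝ 3 w t → ContDiffAt ℝ 1 (deriv (deriv w)) t := fun h =>
    contDiffAt_deriv (c1 h) (by norm_num)
  have d1 : ∀ {z}, z ∈ W.U → ContDiffAt ℝ 3 w (W.f z) →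
      DifferentiableAt ℝ (fun z => deriv w (W.f z)) z := fun hz h =>
    ((c1 h).differentiableAt (by norm_num)).comp _ (diff_of_smooth (contDiffAt_f hz))
  have d2 : DifferentiableAt ℝ (fun z => deriv (deriv w) (W.f z)) q :=
    ((c2 h3).differentiableAt (by norm_num)).comp _ (diff_of_smooth (contDiffAt_f hq))
  have key := compat₁_eq (W := W) hq (τ := fun z => w (W.f z)) (v := fun z => -deriv w (W.f z))
    (a := fun z => deriv (deriv w) (W.f z)) ?_ ?_ ?_ d2 ?_
  · rw [key, (D_comp_f hq ((c2 h3).differentiableAt (by norm_num))).2]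
    ring
  · filter_upwards [hev, eventually_mem hq] with z hz hzU
    exact (D_comp_f hzU (hz.differentiableAt (by norm_num))).1
  · filter_upwards [hev, eventually_mem hq] with z hz hzU
    rw [D₁_neg (d1 hzU hz), (D_comp_f hzU ((c1 hz).differentiableAt (by norm_num))).1, neg_neg]
  · filter_upwards [hev, eventually_mem hq] with z hz hzU
    exact (d1 hzU hz).neg
  · rw [D₂_neg (d1 hq h3), (D_comp_f hq ((c1 h3).differentiableAt (by norm_num))).2, neg_neg]

theorem smoothNear_D₁ (hp : p ∈ W.U) (hu : SmoothNear u p) : SmoothNear (W.D₁ u) p := by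
  filter_upwards [hu, eventually_mem hp] with q hq hqU using smooth_D₁ hqU hq

/-- The kernel of `δ` is stable under the frame derivations. -/
theorem D₂_D₁_eq_D₁_D₁ (hp : p ∈ W.U) (hu : SmoothNear u p) (h : W.D₂ u =ᶠ[𝓝 p] W.D₁ u) :
    W.D₂ (W.D₁ u) =ᶠ[𝓝 p] W.D₁ (W.D₁ u) := by
  filter_upwards [h.eventuallyEq_nhds, hu, eventually_mem hp] with q hq huq hqU
  have h1 := D₁_D₂ hqU (huq.of_le two_le_infty)
  rw [D₁_congr hq, hq.eq_of_nhds] at h1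
  rw [h1]; ring

theorem compat₁_eq_of_smooth (hp : p ∈ W.U) (hu : SmoothNear u p) (h : W.D₂ u =ᶠ[𝓝 p] W.D₁ u) :
    ∀ᶠ q in 𝓝 p, W.compat₁ u q = W.T₀ q - W.T₁ q * W.D₁ u q + W.T₂ q * W.D₁ (W.D₁ u) q
      - W.T₃ q * W.D₁ (W.D₁ (W.D₁ u)) q := by
  have s1 := smoothNear_D₁ hp hu
  have s2 := smoothNear_D₁ hp s1
  have h1 := D₂_D₁_eq_D₁_D₁ hp hu h
  have h2 := D₂_D₁_eq_D₁_D₁ hp s1 h1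
  filter_upwards [s1.eventually_nhds, s2, h1, h2, eventually_mem hp] with q s1 s2 h1 h2 hqU
  rw [compat₁_eq hqU (EventuallyEq.refl _ _) (EventuallyEq.refl _ _)
    (s1.mono fun z hz => diff_of_smooth hz) (diff_of_smooth s2) h1, h2]

/-! ### The compatibility system as a linear system -/

/-- Quadruples `(σ₁, σ₂, τ₁, τ₂)` of functions on the plane. -/
abbrev Quad : Type :=
  (ℝ × ℝ → ℝ) × (ℝ × ℝ → ℝ) × (ℝ × ℝ → ℝ) × (ℝ × ℝ → ℝ)

/-- `x = (σ₁, σ₂, τ₁, τ₂)` is a smooth solution near `p` of the Samuelson equations and the first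
compatibility condition with all inhomogeneous terms multiplied by the constant `κ`: `κ = 1` gives
the original system, `κ = 0` the associated homogeneous system. The first compatibility condition
enters in its expanded form. -/
def SolvesNear (W : Web) (p : ℝ × ℝ) (κ : ℝ) (x : Quad) : Prop :=
  (SmoothNear x.1 p ∧ SmoothNear x.2.1 p ∧ SmoothNear x.2.2.1 p ∧ SmoothNear x.2.2.2 p) ∧
  ∀ᶠ q in 𝓝 p,
    W.D₂ x.1 q = κ * W.H q ∧
    W.D₁ x.2.1 q = κ * W.H q ∧
    W.D₂ x.2.2.1 q = W.D₁ x.2.2.1 q ∧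
    W.b q * W.D₁ x.2.2.2 q - W.D₂ x.2.2.2 q = κ * ((W.b q - 1) * W.H q - W.D₁ W.b q) ∧
    x.1 q + x.2.2.1 q = x.2.1 q + x.2.2.2 q ∧
    κ * W.T₀ q - W.T₁ q * W.D₁ x.2.2.1 q + W.T₂ q * W.D₁ (W.D₁ x.2.2.1) q
      - W.T₃ q * W.D₁ (W.D₁ (W.D₁ x.2.2.1)) q = 0

theorem isSolutionNear_iff (hp : p ∈ W.U) (x : Quad) :
    W.IsSolutionNear p x.1 x.2.1 x.2.2.1 x.2.2.2 ↔
      SolvesNear W p 1 x ∧ ∀ᶠ q in 𝓝 p, W.compat₂ q = 0 := by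
  constructor
  · intro h
    have s3 : SmoothNear x.2.2.1 p := h.mono fun q hq => hq.1.2.2.1
    have hτ : W.D₂ x.2.2.1 =ᶠ[𝓝 p] W.D₁ x.2.2.1 := h.mono fun q hq => by
      linarith [hq.2.1.2.2.1]
    refine ⟨⟨⟨h.mono fun q hq => hq.1.1, h.mono fun q hq => hq.1.2.1, s3,
      h.mono fun q hq => hq.1.2.2.2⟩, ?_⟩, h.mono fun q hq => hq.2.2.2⟩
    filter_upwards [h, compat₁_eq_of_smooth hp s3 hτ] with q hq hc
    obtain ⟨-, ⟨h1, h2, h3, h4, h5⟩, h6, -⟩ := hq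
    refine ⟨by linarith, by linarith, by linarith, by linarith, h5, by linarith⟩
  · rintro ⟨⟨⟨s1, s2, s3, s4⟩, h⟩, hc⟩
    have hτ : W.D₂ x.2.2.1 =ᶠ[𝓝 p] W.D₁ x.2.2.1 := h.mono fun q hq => hq.2.2.1
    filter_upwards [s1, s2, s3, s4, h, hc, compat₁_eq_of_smooth hp s3 hτ]
      with q s1 s2 s3 s4 h hc hc1
    obtain ⟨h1, h2, h3, h4, h5, h6⟩ := h
    exact ⟨⟨s1, s2, s3, s4⟩, ⟨by linarith, by linarith, by linarith, by linarith, h5⟩,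
      by linarith, hc⟩

theorem smoothNear_add_smul (hu : SmoothNear u p) (hv : SmoothNear v p) (a : ℝ) :
    SmoothNear (u + a • v) p := by
  filter_upwards [hu, hv] with q hu hv using hu.add (contDiffAt_const.smul hv)

theorem D₁_add_smul (hu : SmoothNear u p) (hv : SmoothNear v p) (a : ℝ) :
    W.D₁ (u + a • v) =ᶠ[𝓝 p] W.D₁ u + a • W.D₁ v := by
  filter_upwards [hu, hv] with q hu hv
  have := D₁_add (W := W) (diff_of_smooth hu) ((diff_of_smooth hv).const_mul a)
  rw [D₁_const_mul _ (diff_of_smooth hv)] at this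
  exact this

theorem D₂_add_smul (hu : SmoothNear u p) (hv : SmoothNear v p) (a : ℝ) :
    W.D₂ (u + a • v) =ᶠ[𝓝 p] W.D₂ u + a • W.D₂ v := by
  filter_upwards [hu, hv] with q hu hv
  have := D₂_add (W := W) (diff_of_smooth hu) ((diff_of_smooth hv).const_mul a)
  rw [D₂_const_mul _ (diff_of_smooth hv)] at this
  exact this

theorem D₁_D₁_add_smul (hp : p ∈ W.U) (hu : SmoothNear u p) (hv : SmoothNear v p) (a : ℝ) :
    W.D₁ (W.D₁ (u + a • v)) =ᶠ[𝓝 p] W.D₁ (W.D₁ u) + a • W.D₁ (W.D₁ v) :=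
  (eventuallyEq_D₁ (D₁_add_smul hu hv a)).trans
    (D₁_add_smul (smoothNear_D₁ hp hu) (smoothNear_D₁ hp hv) a)

theorem SolvesNear.add_smul (hp : p ∈ W.U) {κ μ : ℝ} {x y : Quad} (hx : SolvesNear W p κ x)
    (hy : SolvesNear W p μ y) (a : ℝ) : SolvesNear W p (κ + a * μ) (x + a • y) := by
  obtain ⟨⟨x1, x2, x3, x4⟩, hx⟩ := hx
  obtain ⟨⟨y1, y2, y3, y4⟩, hy⟩ := hy
  refine ⟨⟨smoothNear_add_smul x1 y1 a, smoothNear_add_smul x2 y2 a, smoothNear_add_smul x3 y3 a,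
    smoothNear_add_smul x4 y4 a⟩, ?_⟩
  have t2 := D₁_D₁_add_smul hp x3 y3 a
  have t3 : W.D₁ (W.D₁ (W.D₁ (x.2.2.1 + a • y.2.2.1))) =ᶠ[𝓝 p] _ := (eventuallyEq_D₁ t2).trans
    (D₁_add_smul (smoothNear_D₁ hp (smoothNear_D₁ hp x3))
      (smoothNear_D₁ hp (smoothNear_D₁ hp y3)) a)
  filter_upwards [hx, hy, D₂_add_smul (W := W) x1 y1 a, D₁_add_smul (W := W) x2 y2 a,
    D₁_add_smul (W := W) x3 y3 a, D₂_add_smul (W := W) x3 y3 a, D₁_add_smul (W := W) x4 y4 a,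
    D₂_add_smul (W := W) x4 y4 a, t2, t3]
    with q ⟨a1, a2, a3, a4, a5, a6⟩ ⟨b1, b2, b3, b4, b5, b6⟩ e1 e2 e3 e4 e5 e6 e7 e8
  simp only [Prod.fst_add, Prod.snd_add, Prod.smul_fst, Prod.smul_snd, e1, e2, e3, e4, e5, e6, e7,
    e8, Pi.add_apply, Pi.smul_apply, smul_eq_mul]
  refine ⟨?_, ?_, ?_, ?_, ?_, ?_⟩
  · linear_combination a1 + a * b1
  · linear_combination a2 + a * b2
  · linear_combination a3 + a * b3
  · linear_combination a4 + a * b4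
  · linear_combination a5 + a * b5
  · linear_combination a6 + a * b6

theorem solvesNear_zero : SolvesNear W p 0 0 := by
  have hz : W.D₁ (0 : ℝ × ℝ → ℝ) = 0 := by funext q; exact D₁_const (W := W) (q := q) 0
  have hz2 : W.D₂ (0 : ℝ × ℝ → ℝ) = 0 := by funext q; exact D₂_const (W := W) (q := q) 0
  have s : SmoothNear (0 : ℝ × ℝ → ℝ) p := Eventually.of_forall fun q => contDiffAt_const
  refine ⟨⟨s, s, s, s⟩, Eventually.of_forall fun q => ?_⟩
  simp [hz, hz2]

/-- The solutions near `p` of the homogeneous system. -/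
def homogeneousSolutions (W : Web) {p : ℝ × ℝ} (hp : p ∈ W.U) : Submodule ℝ Quad where
  carrier := {x | SolvesNear W p 0 x}
  zero_mem' := solvesNear_zero
  add_mem' := fun {x y} hx hy => by simpa using SolvesNear.add_smul hp hx hy 1
  smul_mem' := fun a x hx => by simpa using SolvesNear.add_smul hp solvesNear_zero hx a

/-- The initial data at `p`: the values of `τ₁`, `∂₁τ₁`, `∂₁∂₁τ₁`, `σ₁`, `σ₂`, `∂₁σ₁`. -/
def initialData (W : Web) (p : ℝ × ℝ) (x : Quad) : Fin 6 → ℝ :=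
  ![x.2.2.1 p, W.D₁ x.2.2.1 p, W.D₁ (W.D₁ x.2.2.1) p, x.1 p, x.2.1 p, W.D₁ x.1 p]

theorem initialData_add_smul (hp : p ∈ W.U) {κ μ : ℝ} {x y : Quad} (hx : SolvesNear W p κ x)
    (hy : SolvesNear W p μ y) (a : ℝ) :
    initialData W p (x + a • y) = initialData W p x + a • initialData W p y := by
  have e1 := (D₁_add_smul (W := W) hx.1.2.2.1 hy.1.2.2.1 a).eq_of_nhds
  have e2 := (D₁_D₁_add_smul (W := W) hp hx.1.2.2.1 hy.1.2.2.1 a).eq_of_nhds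
  have e3 := (D₁_add_smul (W := W) hx.1.1 hy.1.1 a).eq_of_nhds
  funext i
  fin_cases i <;> simp [initialData, e1, e2, e3]

/-- Initial data at `p` of homogeneous solutions, as a linear map. -/
def initialDataMap (W : Web) {p : ℝ × ℝ} (hp : p ∈ W.U) :
    homogeneousSolutions W hp →ₗ[ℝ] Fin 6 → ℝ where
  toFun x := initialData W p x
  map_add' x y := by simpa using initialData_add_smul hp x.2 y.2 1
  map_smul' a x := by
    have h0 : initialData W p 0 = 0 := by
      have := initialData_add_smul hp (solvesNear_zero (W := W)) (solvesNear_zero (W := W)) 1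
      simpa using this
    simpa [h0] using initialData_add_smul hp (solvesNear_zero (W := W)) x.2 a

/-- The quadruple of germs at `p` of a quadruple of functions. -/
def germs (p : ℝ × ℝ) : Quad →ₗ[ℝ] GermAt p × GermAt p × GermAt p × GermAt p where
  toFun x := ((x.1 : GermAt p), (x.2.1 : GermAt p), (x.2.2.1 : GermAt p), (x.2.2.2 : GermAt p))
  map_add' _ _ := rfl
  map_smul' _ _ := rfl

theorem mem_solutionGerms_iff (hp : p ∈ W.U)
    {φ : GermAt p × GermAt p × GermAt p × GermAt p} :
    φ ∈ W.solutionGerms p ↔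
      ∃ x, SolvesNear W p 1 x ∧ (∀ᶠ q in 𝓝 p, W.compat₂ q = 0) ∧ φ = germs p x := by
  constructor
  · rintro ⟨σ₁, σ₂, τ₁, τ₂, h, rfl⟩
    have := (isSolutionNear_iff hp (σ₁, σ₂, τ₁, τ₂)).1 h
    exact ⟨_, this.1, this.2, rfl⟩
  · rintro ⟨x, h, hc, rfl⟩
    exact ⟨x.1, x.2.1, x.2.2.1, x.2.2.2, (isSolutionNear_iff hp x).2 ⟨h, hc⟩, rfl⟩

/-! ### Uniqueness of solutions with given initial data -/

theorem eventually_abs_lt (hu : ContinuousAt u p) : ∀ᶠ q in 𝓝 p, |u q| < |u p| + 1 :=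
  hu.abs.eventually_lt continuousAt_const (by linarith)

/-- The prolonged third-order equation for `τ₁`, solved for the highest derivative. -/
theorem SolvesNear.D₁_D₁_D₁ (hp : p ∈ W.U) {κ : ℝ} {x : Quad} (hx : SolvesNear W p κ x) :
    W.D₁ (W.D₁ (W.D₁ x.2.2.1)) =ᶠ[𝓝 p] fun q => κ * (W.T₀ q / W.T₃ q)
      - W.T₁ q / W.T₃ q * W.D₁ x.2.2.1 q + W.T₂ q / W.T₃ q * W.D₁ (W.D₁ x.2.2.1) q := by
  filter_upwards [hx.2, eventually_mem hp] with q ⟨_, _, _, _, _, h⟩ hqU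
  have h3 := T₃_ne hqU
  field_simp
  linarith

/-- All iterated derivatives `∂₁ⁿτ₁` are annihilated by `δ`. -/
theorem SolvesNear.D₂_eq_D₁ (hp : p ∈ W.U) {κ : ℝ} {x : Quad} (hx : SolvesNear W p κ x) :
    W.D₂ x.2.2.1 =ᶠ[𝓝 p] W.D₁ x.2.2.1 ∧
    W.D₂ (W.D₁ x.2.2.1) =ᶠ[𝓝 p] W.D₁ (W.D₁ x.2.2.1) ∧
    W.D₂ (W.D₁ (W.D₁ x.2.2.1)) =ᶠ[𝓝 p] W.D₁ (W.D₁ (W.D₁ x.2.2.1)) ∧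
    W.D₂ (W.D₁ (W.D₁ (W.D₁ x.2.2.1))) =ᶠ[𝓝 p] W.D₁ (W.D₁ (W.D₁ (W.D₁ x.2.2.1))) := by
  have s0 := hx.1.2.2.1
  have s1 := smoothNear_D₁ hp s0
  have s2 := smoothNear_D₁ hp s1
  have h0 : W.D₂ x.2.2.1 =ᶠ[𝓝 p] W.D₁ x.2.2.1 := hx.2.mono fun q hq => hq.2.2.1
  have h1 := D₂_D₁_eq_D₁_D₁ hp s0 h0
  have h2 := D₂_D₁_eq_D₁_D₁ hp s1 h1
  exact ⟨h0, h1, h2, D₂_D₁_eq_D₁_D₁ hp s2 h2⟩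

theorem eventually_tau_eq_zero (hp : p ∈ W.U) {x : Quad} (hx : SolvesNear W p 0 x)
    (h0 : initialData W p x = 0) :
    ∀ᶠ q in 𝓝 p, x.2.2.1 q = 0 := by
  have s0 := hx.1.2.2.1
  have s1 := smoothNear_D₁ hp s0
  have s2 := smoothNear_D₁ hp s1
  obtain ⟨h1, h2, h3, -⟩ := hx.D₂_eq_D₁ hp
  set C := 1 + ((|W.T₁ p / W.T₃ p| + 1) + (|W.T₂ p / W.T₃ p| + 1)) with hC
  have k1 := eventually_abs_lt (smooth_div_T₃ hp (smooth_T₁ hp)).continuousAt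
  have k2 := eventually_abs_lt (smooth_div_T₃ hp (smooth_T₂ hp)).continuousAt
  have hC1 : 1 ≤ C := by
    rw [hC]; linarith [abs_nonneg (W.T₁ p / W.T₃ p), abs_nonneg (W.T₂ p / W.T₃ p)]
  refine eventually_eq_zero_of_frame_le hp
    (u := ![x.2.2.1, W.D₁ x.2.2.1, W.D₁ (W.D₁ x.2.2.1)]) (C := C) ?_ ?_ ?_ 0
  · intro i; fin_cases i
    · exact s0
    · exact s1
    · exact s2
  · have hle : ∀ q i, |(![x.2.2.1, W.D₁ x.2.2.1, W.D₁ (W.D₁ x.2.2.1)] : Fin 3 → ℝ × ℝ → ℝ) i q| ≤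
        ‖fun j => (![x.2.2.1, W.D₁ x.2.2.1, W.D₁ (W.D₁ x.2.2.1)] : Fin 3 → ℝ × ℝ → ℝ) j q‖ :=
      fun q i => norm_le_pi_norm (fun j =>
        (![x.2.2.1, W.D₁ x.2.2.1, W.D₁ (W.D₁ x.2.2.1)] : Fin 3 → ℝ × ℝ → ℝ) j q) i
    intro i; fin_cases i
    · filter_upwards [h1] with q h1
      have := (hle q 1).trans (le_mul_of_one_le_left (norm_nonneg _) hC1)
      exact ⟨this, h1 ▸ this⟩
    · filter_upwards [h2] with q h2
      have := (hle q 2).trans (le_mul_of_one_le_left (norm_nonneg _) hC1)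
      exact ⟨this, h2 ▸ this⟩
    · filter_upwards [h3, hx.D₁_D₁_D₁ hp, k1, k2] with q h3 h4 k1 k2
      have l1 := hle q 1
      have l2 := hle q 2
      simp only [Matrix.cons_val_one, Matrix.cons_val_zero, Matrix.cons_val] at l1 l2
      set N := ‖fun j => (![x.2.2.1, W.D₁ x.2.2.1, W.D₁ (W.D₁ x.2.2.1)] : Fin 3 → ℝ × ℝ → ℝ) j q‖
        with hN
      have hN0 : 0 ≤ N := norm_nonneg _
      have key : |W.D₁ (W.D₁ (W.D₁ x.2.2.1)) q| ≤ C * N := by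
        rw [h4, zero_mul, zero_sub]
        calc |-(W.T₁ q / W.T₃ q * W.D₁ x.2.2.1 q) + W.T₂ q / W.T₃ q * W.D₁ (W.D₁ x.2.2.1) q|
            ≤ |W.T₁ q / W.T₃ q| * |W.D₁ x.2.2.1 q|
              + |W.T₂ q / W.T₃ q| * |W.D₁ (W.D₁ x.2.2.1) q| := by
              rw [← abs_mul, ← abs_mul, ← abs_neg (W.T₁ q / W.T₃ q * _)]
              exact abs_add_le _ _
          _ ≤ (|W.T₁ p / W.T₃ p| + 1) * N + (|W.T₂ p / W.T₃ p| + 1) * N := by gcongr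
          _ ≤ C * N := by rw [hC]; linarith
      exact ⟨key, h3 ▸ key⟩
  · intro i; fin_cases i
    · exact congrFun h0 0
    · exact congrFun h0 1
    · exact congrFun h0 2

/-- A homogeneous solution with zero initial data at `p` vanishes near `p`: first `τ₁`, then
`s = ∂₁σ₁`, which satisfies `∂₁s = r s` and `∂₂s = H s`, then `σ₁`, `σ₂` and `τ₂`. -/
theorem germs_eq_zero_of_initialData (hp : p ∈ W.U) {x : Quad} (hx : SolvesNear W p 0 x)
    (h0 : initialData W p x = 0) : germs p x = 0 := by
  have hτ : x.2.2.1 =ᶠ[𝓝 p] fun _ => 0 := eventually_tau_eq_zero hp hx h0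
  obtain ⟨⟨s1, s2, s3, s4⟩, h⟩ := hx
  have e1 : W.D₂ x.1 =ᶠ[𝓝 p] fun _ => 0 := h.mono fun q hq => by simpa using hq.1
  have e2 : W.D₁ x.2.1 =ᶠ[𝓝 p] fun _ => 0 := h.mono fun q hq => by simpa using hq.2.1
  have e5 : x.2.2.2 =ᶠ[𝓝 p] fun q => x.1 q - x.2.1 q := by
    filter_upwards [h, hτ] with q hq hτ
    linarith [hq.2.2.2.2.1]
  have e3 : W.D₂ x.2.1 =ᶠ[𝓝 p] fun q => -1 * (W.b q * W.D₁ x.1 q) := by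
    filter_upwards [h, e5.eventuallyEq_nhds, s1, s2, e1, e2] with q hq e5 s1 s2 e1 e2
    have h4 := hq.2.2.2.1
    rw [D₁_congr e5, D₂_congr e5, D₁_sub (diff_of_smooth s1) (diff_of_smooth s2),
      D₂_sub (diff_of_smooth s1) (diff_of_smooth s2), e1, e2] at h4
    linarith
  have d2s : ∀ᶠ q in 𝓝 p, W.D₂ (W.D₁ x.1) q = W.H q * W.D₁ x.1 q := by
    filter_upwards [e1.eventuallyEq_nhds, s1, eventually_mem hp] with q e1 s1 hqU
    have := D₁_D₂ hqU (s1.of_le two_le_infty)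
    rw [D₁_congr e1, e1.eq_of_nhds, D₁_const] at this
    linarith
  -- the fourth Samuelson equation now reads `∂₂σ₂ = -b s`, to be differentiated along `∂₁`
  have d1s : ∀ᶠ q in 𝓝 p, W.D₁ (W.D₁ x.1) q = W.r q * W.D₁ x.1 q := by
    filter_upwards [e2.eventuallyEq_nhds, e3.eventuallyEq_nhds, s1, s2, eventually_mem hp]
      with q e2 e3 s1 s2 hqU
    have := D₁_D₂ hqU (s2.of_le two_le_infty)
    have db := diff_of_smooth (contDiffAt_b hqU)
    have ds := diff_of_smooth (smooth_D₁ hqU s1)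
    have hb := b_ne hqU
    rw [D₁_congr e3, e3.eq_of_nhds, D₂_congr e2, D₂_const, e2.eq_of_nhds,
      D₁_const_mul _ (db.fun_mul ds), D₁_mul db ds] at this
    rw [r]
    field_simp
    linear_combination -this
  have hs : ∀ᶠ q in 𝓝 p, W.D₁ x.1 q = 0 := by
    refine eventually_eq_zero_of_frame_le (ι := Fin 1) hp (u := fun _ => W.D₁ x.1)
      (C := (|W.r p| + 1) + (|W.H p| + 1)) (fun _ => smoothNear_D₁ hp s1) (fun _ => ?_)
      (fun _ => congrFun h0 5) 0
    filter_upwards [d1s, d2s, eventually_abs_lt (smooth_r hp).continuousAt,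
      eventually_abs_lt (smooth_H hp).continuousAt] with q d1 d2 k1 k2
    have hn : |W.D₁ x.1 q| ≤ ‖fun _ : Fin 1 => W.D₁ x.1 q‖ :=
      norm_le_pi_norm (fun _ : Fin 1 => W.D₁ x.1 q) 0
    rw [d1, d2, abs_mul, abs_mul]
    have hr := abs_nonneg (W.r p)
    have hH := abs_nonneg (W.H p)
    constructor
    · gcongr; linarith
    · gcongr; linarith
  have hconst : ∀ u : ℝ × ℝ → ℝ, SmoothNear u p → (∀ᶠ q in 𝓝 p, W.D₁ u q = 0) →
      (∀ᶠ q in 𝓝 p, W.D₂ u q = 0) → u p = 0 → ∀ᶠ q in 𝓝 p, u q = 0 := by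
    intro u su h1 h2 hu
    refine eventually_eq_zero_of_frame_le (ι := Fin 1) hp (u := fun _ => u) (C := 0)
      (fun _ => su) (fun _ => ?_) (fun _ => hu) 0
    filter_upwards [h1, h2] with q h1 h2
    simp [h1, h2]
  have z1 : x.1 =ᶠ[𝓝 p] fun _ => 0 := hconst _ s1 hs e1 (congrFun h0 3)
  have z2 : x.2.1 =ᶠ[𝓝 p] fun _ => 0 := hconst _ s2 e2
    (by filter_upwards [e3, hs] with q e3 hs; rw [e3, hs]; ring) (congrFun h0 4)
  have z4 : x.2.2.2 =ᶠ[𝓝 p] fun _ => 0 := by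
    filter_upwards [e5, z1, z2] with q e5 z1 z2
    rw [e5, z1, z2, sub_zero]
  exact Prod.ext (Germ.coe_eq.2 z1) (Prod.ext (Germ.coe_eq.2 z2)
    (Prod.ext (Germ.coe_eq.2 hτ) (Germ.coe_eq.2 z4)))

theorem initialData_eq_zero_of_germs {x : Quad} (h : germs p x = 0) :
    initialData W p x = 0 := by
  have z1 : x.1 =ᶠ[𝓝 p] fun _ => 0 := Germ.coe_eq.1 (congrArg (fun y => y.1) h)
  have z2 : x.2.1 =ᶠ[𝓝 p] fun _ => 0 := Germ.coe_eq.1 (congrArg (fun y => y.2.1) h)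
  have z3 : x.2.2.1 =ᶠ[𝓝 p] fun _ => 0 := Germ.coe_eq.1 (congrArg (fun y => y.2.2.1) h)
  have c0 : W.D₁ (fun _ => (0 : ℝ)) = fun _ => 0 := funext fun q => D₁_const 0
  have a1 := eventuallyEq_D₁ (W := W) z1
  have a3 := eventuallyEq_D₁ (W := W) z3
  have a33 := eventuallyEq_D₁ (W := W) a3
  rw [c0] at a1 a3 a33
  rw [c0] at a33
  funext i
  fin_cases i
  · exact z3.eq_of_nhds
  · exact a3.eq_of_nhds
  · exact a33.eq_of_nhds
  · exact z1.eq_of_nhds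
  · exact z2.eq_of_nhds
  · exact a1.eq_of_nhds

/-! ### Existence of solutions with given initial data -/

/-- The prolonged linear system for `s = ∂₁σ₁` has a solution with arbitrary value at `p` when both
compatibility conditions hold: with `dμ = r ω₁ + H ω₂`, it is `e^μ` times a primitive. -/
theorem exists_prolonged (hp : p ∈ W.U) {τ : ℝ × ℝ → ℝ} (hτ : SmoothNear τ p)
    (h1 : ∀ᶠ q in 𝓝 p, W.compat₁ τ q = 0) (h2 : ∀ᶠ q in 𝓝 p, W.compat₂ q = 0) (a : ℝ) :
    ∃ s, SmoothNear s p ∧ s p = a ∧ ∀ᶠ q in 𝓝 p, W.D₁ s q = W.R τ q + W.r q * s q ∧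
      W.D₂ s q = W.D₁ W.H q - W.H q ^ 2 + W.H q * s q := by
  have hU := eventually_mem hp
  have sH : SmoothNear W.H p := hU.mono fun q hq => smooth_H hq
  have sr : SmoothNear W.r p := hU.mono fun q hq => smooth_r hq
  have sR : SmoothNear (W.R τ) p := by
    filter_upwards [hU, hτ] with q hq hτ using smooth_R hq hτ
  obtain ⟨μ, sμ, μ0, hμ⟩ := exists_primitive hp sr sH (by
    filter_upwards [h2] with q h2
    rw [compat₂] at h2
    linear_combination -h2) 0
  set E : ℝ × ℝ → ℝ := fun q => Real.exp (-μ q) with hE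
  have sE : SmoothNear E p := sμ.mono fun q hq => hq.neg.exp
  have dE : ∀ᶠ q in 𝓝 p, W.D₁ E q = -(W.r q * E q) ∧ W.D₂ E q = -(W.H q * E q) := by
    filter_upwards [sμ, hμ] with q sμ hμ
    have dμ := diff_of_smooth sμ
    have e1 := D₁_comp (W := W) (w := fun t => Real.exp (-t)) (u := μ) (q := q)
      (by fun_prop) dμ
    have e2 := D₂_comp (W := W) (w := fun t => Real.exp (-t)) (u := μ) (q := q)
      (by fun_prop) dμ
    have hd : deriv (fun t => Real.exp (-t)) (μ q) = -Real.exp (-μ q) := by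
      simpa using ((hasDerivAt_id' (μ q)).neg.exp).deriv
    rw [hd] at e1 e2
    simp only [hE, e1, e2, hμ.1, hμ.2]
    constructor <;> ring
  obtain ⟨z, sz, z0, hz⟩ := exists_primitive hp (g₁ := fun q => E q * W.R τ q)
    (g₂ := fun q => E q * (W.D₁ W.H q - W.H q * W.H q))
    (by filter_upwards [sE, sR] with q a b using a.mul b)
    (by filter_upwards [sE, sH, hU] with q a b hq
        exact a.mul ((smooth_D₁ hq b).sub (b.mul b))) (by
    filter_upwards [sE, sH, sR, hU, h1, dE] with q sE sH sR hq h1 dE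
    have dEd := diff_of_smooth sE
    have dH := diff_of_smooth sH
    have dR := diff_of_smooth sR
    have dH1 := diff_of_smooth (smooth_D₁ hq sH)
    rw [D₁_mul dEd (dH1.fun_sub (dH.fun_mul dH)), D₁_sub dH1 (dH.fun_mul dH), D₁_mul dH dH,
      D₂_mul dEd dR, dE.1, dE.2]
    rw [compat₁] at h1
    linear_combination (-E q) * h1) a
  refine ⟨fun q => Real.exp (μ q) * z q, ?_, by simp [μ0, z0], ?_⟩
  · filter_upwards [sμ, sz] with q a b using a.exp.mul b
  · filter_upwards [sμ, sz, hμ, hz] with q sμ sz hμ hz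
    have dμ := diff_of_smooth sμ
    have dz := diff_of_smooth sz
    have e1 := D₁_comp (W := W) (w := Real.exp) (u := μ) (q := q) (by fun_prop) dμ
    have e2 := D₂_comp (W := W) (w := Real.exp) (u := μ) (q := q) (by fun_prop) dμ
    have hinv : Real.exp (μ q) * E q = 1 := by rw [hE, ← Real.exp_add]; simp
    have deμ : DifferentiableAt ℝ (fun q => Real.exp (μ q)) q := dμ.exp
    rw [D₁_mul deμ dz, D₂_mul deμ dz, e1, e2, hz.1, hz.2, hμ.1, hμ.2, Real.deriv_exp]
    constructor
    · linear_combination (W.R τ q) * hinv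
    · linear_combination (W.D₁ W.H q - W.H q ^ 2) * hinv

/-- When the second compatibility condition holds near `p`, each `τ₁` satisfying the first
completes to a solution with arbitrary values of `σ₁`, `σ₂` and `∂₁σ₁` at `p`. -/
theorem exists_solvesNear_of_tau (hp : p ∈ W.U) {τ : ℝ × ℝ → ℝ} (hτ : SmoothNear τ p)
    (hδ : W.D₂ τ =ᶠ[𝓝 p] W.D₁ τ) (h1 : ∀ᶠ q in 𝓝 p, W.compat₁ τ q = 0)
    (h2 : ∀ᶠ q in 𝓝 p, W.compat₂ q = 0) (a₃ a₄ a₅ : ℝ) :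
    ∃ x : Quad, SolvesNear W p 1 x ∧ x.2.2.1 = τ ∧ x.1 p = a₃ ∧ x.2.1 p = a₄ ∧
      W.D₁ x.1 p = a₅ := by
  have hU := eventually_mem hp
  have sH : SmoothNear W.H p := hU.mono fun q hq => smooth_H hq
  have sB : SmoothNear (W.B τ) p := by
    filter_upwards [hU, hτ] with q hq hτ using smooth_B hq hτ
  obtain ⟨s, ss, s0, hs⟩ := exists_prolonged hp hτ h1 h2 a₅
  obtain ⟨σ₁, sσ₁, σ₁0, hσ₁⟩ := exists_primitive hp ss sH (by
    filter_upwards [hs] with q hs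
    rw [hs.2]; ring) a₃
  obtain ⟨σ₂, sσ₂, σ₂0, hσ₂⟩ := exists_primitive hp (g₂ := fun q => W.B τ q - W.b q * s q) sH
    (by filter_upwards [sB, ss, hU] with q a b hq using a.sub ((contDiffAt_b hq).mul b)) (by
    filter_upwards [hs, sB, ss, hU] with q hs sB ss hq
    have dB := diff_of_smooth sB
    have ds := diff_of_smooth ss
    have db := diff_of_smooth (contDiffAt_b hq)
    have hb := b_ne hq
    rw [D₁_sub dB (db.fun_mul ds), D₁_mul db ds, hs.1, R, r]
    field_simp
    ring) a₄
  have st : SmoothNear (fun q => σ₁ q + τ q - σ₂ q) p := by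
    filter_upwards [sσ₁, hτ, sσ₂] with q a b c using (a.add b).sub c
  refine ⟨(σ₁, σ₂, τ, fun q => σ₁ q + τ q - σ₂ q), ⟨⟨sσ₁, sσ₂, hτ, st⟩, ?_⟩, rfl, σ₁0, σ₂0, ?_⟩
  · filter_upwards [hσ₁, hσ₂, sσ₁, sσ₂, hτ, hδ, h1, compat₁_eq_of_smooth hp hτ hδ]
      with q hσ₁ hσ₂ sσ₁ sσ₂ hτ hδ h1 hc
    have d1 := diff_of_smooth sσ₁
    have d2 := diff_of_smooth sσ₂
    have dt := diff_of_smooth hτ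
    refine ⟨by rw [hσ₁.2, one_mul], by rw [hσ₂.1, one_mul], hδ, ?_, by ring, by linarith⟩
    rw [D₁_sub (d1.fun_add dt) d2, D₁_add d1 dt, D₂_sub (d1.fun_add dt) d2, D₂_add d1 dt, hσ₁.1,
      hσ₁.2, hσ₂.1, hσ₂.2, hδ, B]
    ring
  · simpa [s0] using hσ₁.self_of_nhds.1

/-- Under the conditions of the theorem, all initial data at `p` are attained. The coefficients
`Tᵢ / T₃` being functions of `f`, the function `w` is found from an ordinary differential
equation. -/
theorem exists_solvesNear (hp : p ∈ W.U) (h2 : ∀ᶠ q in 𝓝 p, W.compat₂ q = 0)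
    (hT : ∀ᶠ q in 𝓝 p, W.CoefficientCondition q) (d : Fin 6 → ℝ) :
    ∃ x : Quad, SolvesNear W p 1 x ∧ initialData W p x = d := by
  have hU := eventually_mem hp
  obtain ⟨φ₂, s2, e2⟩ := exists_eq_comp_f hp (hU.mono fun q hq => smooth_div_T₃ hq (smooth_T₂ hq))
    (hT.mono fun q hq => hq.1)
  obtain ⟨φ₁, s1, e1⟩ := exists_eq_comp_f hp (hU.mono fun q hq => smooth_div_T₃ hq (smooth_T₁ hq))
    (hT.mono fun q hq => hq.2.1)
  obtain ⟨φ₀, s0, e0⟩ := exists_eq_comp_f hp (hU.mono fun q hq => smooth_div_T₃ hq (smooth_T₀ hq))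
    (hT.mono fun q hq => hq.2.2)
  -- the minus sign: `∂₁τ₁ = -w'(f)`
  obtain ⟨w, sw, w0, w1, w2, w3⟩ := exists_solution_linear_ode s0 s1 s2 (d 0) (-d 1) (d 2)
  have tf := tendsto_f hp
  have sτ : SmoothNear (fun z => w (W.f z)) p := by
    filter_upwards [tf.eventually sw, hU] with q hw hq
    exact ContDiffAt.comp q hw (contDiffAt_f hq)
  have hc : ∀ᶠ q in 𝓝 p, W.compat₁ (fun z => w (W.f z)) q = 0 := by
    filter_upwards [tf.eventually sw, tf.eventually w3, hU, e0, e1, e2] with q hw w3 hq e0 e1 e2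
    have h3 := T₃_ne hq
    rw [compat₁_comp_f hq hw, w3, ← e0, ← e1, ← e2]
    field_simp
    ring
  have hD : ∀ᶠ q in 𝓝 p, W.D₁ (fun z => w (W.f z)) q = -deriv w (W.f q) ∧
      W.D₂ (fun z => w (W.f z)) q = -deriv w (W.f q) := by
    filter_upwards [tf.eventually sw, hU] with q hw hq
    exact D_comp_f hq (hw.differentiableAt (by simp))
  obtain ⟨x, hx, xτ, x3, x4, x5⟩ := exists_solvesNear_of_tau hp sτ
    (hD.mono fun q hq => hq.2.trans hq.1.symm) hc h2 (d 3) (d 4) (d 5)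
  refine ⟨x, hx, ?_⟩
  have hdw : DifferentiableAt ℝ (deriv w) (W.f p) :=
    (contDiffAt_deriv (sw.self.of_le two_le_infty) (m := 1)
      (by norm_num)).differentiableAt (by norm_num)
  have dd : W.D₁ (W.D₁ x.2.2.1) p = d 2 := by
    have he : W.D₁ x.2.2.1 =ᶠ[𝓝 p] fun z => -deriv w (W.f z) := by
      rw [xτ]; exact hD.mono fun q hq => hq.1
    have hcomp : DifferentiableAt ℝ (fun z => deriv w (W.f z)) p :=
      hdw.comp p (diff_of_smooth (contDiffAt_f hp))
    rw [D₁_congr he, D₁_neg hcomp, (D_comp_f hp hdw).1, neg_neg, ← w2, iteratedDeriv_succ,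
      iteratedDeriv_one]
  have dv : W.D₁ x.2.2.1 p = d 1 := by
    rw [xτ, hD.self_of_nhds.1, w1, neg_neg]
  have dτ : x.2.2.1 p = d 0 := by rw [xτ]; exact w0
  funext i
  fin_cases i
  · exact dτ
  · exact dv
  · exact dd
  · exact x3
  · exact x4
  · exact x5

/-! ### The rank -/

/-- A homogeneous solution has zero germ exactly when its initial data vanish. -/
theorem ker_germs_eq (hp : p ∈ W.U) :
    LinearMap.ker ((germs p).domRestrict (homogeneousSolutions W hp))
      = LinearMap.ker (initialDataMap W hp) := by
  ext x
  simp only [LinearMap.mem_ker]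
  exact ⟨fun h => initialData_eq_zero_of_germs h,
    fun h => germs_eq_zero_of_initialData hp x.2 h⟩

/-- The space of germs of homogeneous solutions has the dimension of the space of attained initial
data. -/
theorem rank_range_germs (hp : p ∈ W.U) :
    Module.rank ℝ (LinearMap.range ((germs p).domRestrict (homogeneousSolutions W hp)))
      = Module.rank ℝ (LinearMap.range (initialDataMap W hp)) :=
  (((LinearMap.quotKerEquivRange _).symm.trans
    (Submodule.quotEquivOfEq _ _ (ker_germs_eq hp))).trans
      (LinearMap.quotKerEquivRange _)).rank_eq

theorem vectorSpan_solutionGerms_le (hp : p ∈ W.U) :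
    vectorSpan ℝ (W.solutionGerms p)
      ≤ LinearMap.range ((germs p).domRestrict (homogeneousSolutions W hp)) := by
  rw [vectorSpan, Submodule.span_le]
  rintro _ ⟨φ, hφ, ψ, hψ, rfl⟩
  obtain ⟨x, hx, -, rfl⟩ := (mem_solutionGerms_iff hp).1 hφ
  obtain ⟨y, hy, -, rfl⟩ := (mem_solutionGerms_iff hp).1 hψ
  have hxy := SolvesNear.add_smul hp hx hy (-1)
  have hxy' : SolvesNear W p 0 (x - y) := by
    simpa [← sub_eq_add_neg] using hxy
  exact ⟨⟨x - y, hxy'⟩, map_sub (germs p) x y⟩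

theorem rank_range_initialData_le (hp : p ∈ W.U) :
    Module.rank ℝ (LinearMap.range (initialDataMap W hp)) ≤ 6 := by
  simpa using Submodule.rank_le (LinearMap.range (initialDataMap W hp))

theorem rank_le_range (hp : p ∈ W.U) :
    W.rank p ≤ Module.rank ℝ (LinearMap.range (initialDataMap W hp)) :=
  (Submodule.rank_mono (vectorSpan_solutionGerms_le hp)).trans_eq (rank_range_germs hp)

theorem rank_le_six (hp : p ∈ W.U) : W.rank p ≤ 6 :=
  (rank_le_range hp).trans (rank_range_initialData_le hp)

theorem rank_eq_six (hp : p ∈ W.U) (h2 : ∀ᶠ q in 𝓝 p, W.compat₂ q = 0)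
    (hT : ∀ᶠ q in 𝓝 p, W.CoefficientCondition q) : W.rank p = 6 := by
  obtain ⟨x₀, hx₀, e₀⟩ := exists_solvesNear hp h2 hT 0
  have htop : LinearMap.range (initialDataMap W hp) = ⊤ := by
    refine LinearMap.range_eq_top.2 fun d => ?_
    obtain ⟨x, hx, e⟩ := exists_solvesNear hp h2 hT d
    refine ⟨⟨x + (-1 : ℝ) • x₀, ?_⟩, ?_⟩
    · simpa using! SolvesNear.add_smul hp hx hx₀ (-1)
    · have := initialData_add_smul hp hx hx₀ (-1)
      rw [e, e₀, smul_zero, add_zero] at this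
      exact this
  have hle : LinearMap.range ((germs p).domRestrict (homogeneousSolutions W hp))
      ≤ vectorSpan ℝ (W.solutionGerms p) := by
    rintro _ ⟨⟨y, hy⟩, rfl⟩
    have hs : SolvesNear W p 1 (x₀ + y) := by
      simpa using SolvesNear.add_smul hp hx₀ (show SolvesNear W p 0 y from hy) 1
    have := vsub_mem_vectorSpan ℝ ((mem_solutionGerms_iff hp).2 ⟨x₀ + y, hs, h2, rfl⟩)
      ((mem_solutionGerms_iff hp).2 ⟨x₀, hx₀, h2, rfl⟩)
    have he : germs p (x₀ + y) -ᵥ germs p x₀ = germs p y := by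
      rw [map_add, vsub_eq_sub, add_sub_cancel_left]
    rw [he] at this
    exact this
  have h6 : Module.rank ℝ (LinearMap.range (initialDataMap W hp)) = 6 := by
    rw [htop, rank_top]; simp
  refine le_antisymm (rank_le_six hp) ?_
  rw [← h6, ← rank_range_germs hp]
  exact Submodule.rank_mono hle

/-- The integrability condition of the third-order equation for `τ₁`: the result of applying `δ` to
the expression for `∂₁∂₁∂₁τ₁`. -/
theorem SolvesNear.integrability (hp : p ∈ W.U) {κ : ℝ} {x : Quad} (hx : SolvesNear W p κ x) :
    ∀ᶠ q in 𝓝 p, κ * W.δ (fun z => W.T₀ z / W.T₃ z) q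
      - W.δ (fun z => W.T₁ z / W.T₃ z) q * W.D₁ x.2.2.1 q
      + W.δ (fun z => W.T₂ z / W.T₃ z) q * W.D₁ (W.D₁ x.2.2.1) q = 0 := by
  obtain ⟨-, h1, h2, h3⟩ := hx.D₂_eq_D₁ hp
  have s1 := smoothNear_D₁ hp hx.1.2.2.1
  have s2 := smoothNear_D₁ hp s1
  filter_upwards [h1, h2, h3, (hx.D₁_D₁_D₁ hp).eventuallyEq_nhds, s1, s2, eventually_mem hp]
    with q h1 h2 h3 he s1 s2 hq
  have k0 := diff_of_smooth (smooth_div_T₃ hq (smooth_T₀ hq))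
  have k1 := diff_of_smooth (smooth_div_T₃ hq (smooth_T₁ hq))
  have k2 := diff_of_smooth (smooth_div_T₃ hq (smooth_T₂ hq))
  have d1 := diff_of_smooth s1
  have d2 := diff_of_smooth s2
  rw [D₁_congr he, D₂_congr he,
    D₁_add ((k0.const_mul κ).fun_sub (k1.fun_mul d1)) (k2.fun_mul d2),
    D₂_add ((k0.const_mul κ).fun_sub (k1.fun_mul d1)) (k2.fun_mul d2),
    D₁_sub (k0.const_mul κ) (k1.fun_mul d1), D₂_sub (k0.const_mul κ) (k1.fun_mul d1),
    D₁_const_mul κ k0, D₂_const_mul κ k0, D₁_mul k1 d1, D₂_mul k1 d1, D₁_mul k2 d2, D₂_mul k2 d2,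
    h1, h2] at h3
  simp only [δ]
  linear_combination -h3

theorem conditions_of_rank_eq_six (hp : p ∈ W.U) (h : W.rank p = 6) :
    ∀ᶠ q in 𝓝 p, W.CurvatureCondition q ∧ W.CoefficientCondition q := by
  have hne : (W.solutionGerms p).Nonempty := by
    rw [Set.nonempty_iff_ne_empty]
    intro he
    rw [rank, he, vectorSpan_empty, rank_bot] at h
    norm_num at h
  obtain ⟨φ, hφ⟩ := hne
  obtain ⟨x, hx, hc, -⟩ := (mem_solutionGerms_iff hp).1 hφ
  have hr : Module.rank ℝ (LinearMap.range (initialDataMap W hp)) = 6 :=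
    le_antisymm (rank_range_initialData_le hp) (h ▸ rank_le_range hp)
  have htop : LinearMap.range (initialDataMap W hp) = ⊤ := by
    refine Submodule.eq_top_of_finrank_eq ?_
    rw [Module.finrank, hr]; simp
  obtain ⟨⟨y, hy⟩, ey⟩ := LinearMap.range_eq_top.1 htop ![0, 1, 0, 0, 0, 0]
  obtain ⟨⟨z, hz⟩, ez⟩ := LinearMap.range_eq_top.1 htop ![0, 0, 1, 0, 0, 0]
  have hy' : SolvesNear W p 0 y := hy
  have hz' : SolvesNear W p 0 z := hz
  -- the data `(∂₁τ₁, ∂₁∂₁τ₁)` of `y` and `z`, independent at `p`, stay independent near `p`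
  set det : ℝ × ℝ → ℝ := fun q => W.D₁ y.2.2.1 q * W.D₁ (W.D₁ z.2.2.1) q
    - W.D₁ (W.D₁ y.2.2.1) q * W.D₁ z.2.2.1 q with hdet
  have sy := smoothNear_D₁ hp hy'.1.2.2.1
  have sz := smoothNear_D₁ hp hz'.1.2.2.1
  have hdc : ContinuousAt det p :=
    (sy.self.continuousAt.mul (smooth_D₁ hp sz.self).continuousAt).sub
      ((smooth_D₁ hp sy.self).continuousAt.mul sz.self.continuousAt)
  have hd1 : det p ≠ 0 := by
    have y1 : W.D₁ y.2.2.1 p = 1 := congrFun ey 1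
    have y2 : W.D₁ (W.D₁ y.2.2.1) p = 0 := congrFun ey 2
    have z2 : W.D₁ (W.D₁ z.2.2.1) p = 1 := congrFun ez 2
    simp [hdet, y1, y2, z2]
  filter_upwards [hc, eventually_mem hp, hdc.eventually_ne hd1, hx.integrability hp,
    hy'.integrability hp, hz'.integrability hp] with q hc hq hd ix iy iz
  refine ⟨(compat₂_eq_zero_iff hq).1 hc, ?_⟩
  have k2 : W.δ (fun z => W.T₂ z / W.T₃ z) q = 0 := by
    refine (mul_eq_zero.1 (?_ : det q * _ = 0)).resolve_left hd
    simp only [hdet]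
    linear_combination W.D₁ y.2.2.1 q * iz - W.D₁ z.2.2.1 q * iy
  have k1 : W.δ (fun z => W.T₁ z / W.T₃ z) q = 0 := by
    refine (mul_eq_zero.1 (?_ : det q * _ = 0)).resolve_left hd
    simp only [hdet]
    linear_combination W.D₁ (W.D₁ y.2.2.1) q * iz - W.D₁ (W.D₁ z.2.2.1) q * iy
  refine ⟨k2, k1, ?_⟩
  rw [k1, k2] at ix
  linarith

theorem rank_eq_six_iff (hp : p ∈ W.U) :
    W.rank p = 6 ↔ ∀ᶠ q in 𝓝 p, W.CurvatureCondition q ∧ W.CoefficientCondition q := by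
  refine ⟨conditions_of_rank_eq_six hp, fun h => rank_eq_six hp ?_ (h.mono fun q hq => hq.2)⟩
  filter_upwards [h, eventually_mem hp] with q hq hqU
  exact (compat₂_eq_zero_iff hqU).2 hq.1

end Web

end Samuelson

end

theorem mainTheorem1 (W : Samuelson.Web) :
    -- the first compatibility condition is a third-order ODE for `w`, where `τ₁ = w(f)`
    (∀ q ∈ W.U, W.T₃ q ≠ 0 ∧ ∀ w : ℝ → ℝ, ContDiffAt ℝ ∞ w (W.f q) →
      W.compat₁ (fun z => w (W.f z)) q =
        W.T₃ q * iteratedDeriv 3 w (W.f q) + W.T₂ q * iteratedDeriv 2 w (W.f q)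
          + W.T₁ q * deriv w (W.f q) + W.T₀ q) ∧
    -- the rank never exceeds six, and when it equals six
    (∀ p ∈ W.U, W.rank p ≤ 6 ∧
      (W.rank p = 6 ↔ ∀ᶠ q in 𝓝 p, W.CurvatureCondition q ∧ W.CoefficientCondition q)) ∧
    ((∀ p ∈ W.U, W.rank p = 6) ↔
      ∀ q ∈ W.U, W.CurvatureCondition q ∧ W.CoefficientCondition q) := by
  refine ⟨fun q hq => ⟨Samuelson.Web.T₃_ne hq, fun w hw => Samuelson.Web.compat₁_comp_f hq hw⟩,
    fun p hp => ⟨Samuelson.Web.rank_le_six hp, Samuelson.Web.rank_eq_six_iff hp⟩, ?_⟩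
  constructor
  · intro h q hq
    exact ((Samuelson.Web.rank_eq_six_iff hq).1 (h q hq)).self_of_nhds
  · intro h p hp
    refine (Samuelson.Web.rank_eq_six_iff hp).2 ?_
    filter_upwards [Samuelson.Web.eventually_mem hp] with q hq using h q hq
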